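/- For $N\ge 1$ let $\boldsymbol y=(y_e)$ be the edge indicators of the random graph $G(N,1/2)$, i.e. $\binom N2$ i.i.d. $\mathrm{Ber}(1/2)$ variables indexed by the unordered pairs of distinct elements of $[N]=\{1,\dots,N\}$, and let $\omega$ be a random variable independent of $\boldsymbol y$, taking values in some measurable space $\Omega_N$. A function $g:\{0,1\}^{\binom N2}\to\mathbb R$ is a *degree $D$ function* if it lies in the linear span of the functions $y\mapsto\prod_{e\in I}f_e(y_e)$ with $|I|\le D$ and arbitrary $f_e:\{0,1\}\to\mathbb R$. A measurable map $\mathcal A^\circ=\mathcal A^\circ_N:\{0,1\}^{\binom N2}\times\Omega_N\to\mathbb R^N$ is a degree $D$ function if, for every fixed $\omega$, each of its $N$ coordinates is a degree $D$ function of $y$. Define $\mathsf{round}:\mathbb R\to\{0,1,*\}$ by $\mathsf{round}(z)=0$ if $|z|\le 1/2$, $\mathsf{round}(z)=1$ if $|z|\ge 1$, and $\mathsf{round}(z)=*$ otherwise, and apply it entrywise to vectors. For $b>0$, a function $F:\{0,1,*\}^N\times\{0,1\}^{\binom N2}\to\mathcal P([N])\cup\{\mathsf{err}\}$ is *$b$-repairing*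 if, whenever $F(z,y)=S\ne\mathsf{err}$, the set $S$ is an independent set of the graph $y$ and the Hamming distance $|\{i\in[N]:(\mathbb 1_S)_i\ne z_i\}|$ is at most $b\log_2 N$. **Corollary.** For every $\iota>0$ there exists $b>0$ such that the following holds. Let $C$ be a constant, let $D=D(N)=o(\log^2 N)$, and for each $N$ let $\mathcal A^\circ_N$ be a degree $D(N)$ function such that $\mathbb E\big[\|\mathcal A^\circ_N(\boldsymbol y,\omega)\|^2\big]\le C\log N$ for all sufficiently large $N$. For each $N$ let $F_N$ be an arbitrary $b$-repairing function, and put $\mathcal A_N(\boldsymbol y,\omega)=F_N\big(\mathsf{round}(\mathcal A^\circ_N(\boldsymbol y,\omega)),\boldsymbol y\big)$. Then, as $N\to\infty$, $$\mathbb P\big[\mathcal A_N(\boldsymbol y,\omega)\text{ is an independent set of }\boldsymbol y\text{ of size at least }(1+\iota)\log_2 N\big]=o(1).$$ -/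

import Mathlib

open MeasureTheory ProbabilityTheory Filter Topology Asymptotics

namespace DenseIndSet

/-- The `N.choose 2` unordered pairs of distinct vertices of `[N]`. -/
abbrev Pair (N : ℕ) : Type := {e : Sym2 (Fin N) // ¬ e.IsDiag}

/-- An element of `{0,1}^(N choose 2)`: a graph on `[N]`, given by the indicators of its edges. -/
abbrev Input (N : ℕ) : Type := Pair N → Bool

/-- The graph on `[N]` encoded by `y`. -/
def graph {N : ℕ} (y : Input N) : SimpleGraph (Fin N) :=
  SimpleGraph.fromEdgeSet {e | ∃ h : ¬ e.IsDiag, y ⟨e, h⟩ = true}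

/-- The probability `1/2`. -/
noncomputable def half : unitInterval := ⟨1 / 2, Set.mem_Icc.2 (by norm_num)⟩

/-- The law of `G(N, 1/2)`: the entries of `y` are i.i.d. Bernoulli variables of parameter `1/2`. -/
noncomputable def gnpHalf (N : ℕ) : Measure (Input N) :=
  Measure.pi fun _ => bernoulliMeasure true false half

/-- The space of degree `D` functions on `Γ^d`: the linear span of the functions
`y ↦ ∏ i ∈ I, f i (y i)` with `|I| ≤ D` and arbitrary `f i : Γ → ℝ`. -/
def degreeFunctions (d Γ : Type*) (D : ℕ) : Submodule ℝ ((d → Γ) → ℝ) :=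
  Submodule.span ℝ {g | ∃ (I : Finset d) (f : d → Γ → ℝ), I.card ≤ D ∧
    g = fun y => ∏ i ∈ I, f i (y i)}

/-- `A(y, ω)` is a degree `D` function: for every fixed `ω`, each of its `N` output coordinates is
a degree `D` function of `y`. -/
def IsDegree {N : ℕ} {Ω : Type*} (A : Input N → Ω → EuclideanSpace ℝ (Fin N)) (D : ℕ) : Prop :=
  ∀ ω i, (fun y => A y ω i) ∈ degreeFunctions (Pair N) Bool D

/-- Rounding of a real number to `{0, 1, *}`, where `0`, `1`, `*` are `some false`, `some true`,
`none`. -/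
noncomputable def roundEntry (z : ℝ) : Option Bool :=
  if |z| ≤ 1 / 2 then some false else if 1 ≤ |z| then some true else none

/-- Entrywise rounding of a vector. -/
noncomputable def roundVec {N : ℕ} (z : EuclideanSpace ℝ (Fin N)) : Fin N → Option Bool :=
  fun i => roundEntry (z i)

/-- The indicator vector of `S`, as an element of `{0, 1, *}^N`. -/
def indicatorVec {N : ℕ} (S : Finset (Fin N)) : Fin N → Option Bool :=
  fun i => some (decide (i ∈ S))

/-- `F : {0,1,*}^N × {0,1}^(N choose 2) → 𝒫([N]) ∪ {err}` (with `err` being `none`) is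
`b`-repairing: whenever it outputs a set `S`, this is an independent set of `y` whose indicator
vector is within Hamming distance `b log₂ N` of the rounded vector `z`. -/
def IsRepairing {N : ℕ} (b : ℝ)
    (F : (Fin N → Option Bool) → Input N → Option (Finset (Fin N))) : Prop :=
  ∀ z y S, F z y = some S →
    (graph y).IsIndepSet (S : Set (Fin N)) ∧
      (hammingDist (indicatorVec S) z : ℝ) ≤ b * Real.logb 2 N

/-- The final output `F(round(A(y, ω)), y)`. -/
noncomputable def output {N : ℕ} {Ω : Type*} (A : Input N → Ω → EuclideanSpace ℝ (Fin N))
    (F : (Fin N → Option Bool) → Input N → Option (Finset (Fin N)))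
    (y : Input N) (ω : Ω) : Option (Finset (Fin N)) :=
  F (roundVec (A y ω)) y

/-- The output `o` is (a set, not `err`, and) an independent set of `y` of size at least
`(1 + ι) log₂ N`. -/
def IsLargeIndepSet {N : ℕ} (ι : ℝ) (y : Input N) (o : Option (Finset (Fin N))) : Prop :=
  ∃ S, o = some S ∧ (graph y).IsIndepSet (S : Set (Fin N)) ∧
    (1 + ι) * Real.logb 2 N ≤ (S.card : ℝ)

end DenseIndSet

namespace DenseIndSet

/-! Write L = log₂ N. Averaging over ω reduces the claim to a deterministic A succeeding on a set G
of inputs of density at least some constant p. Run the stationary noise chain on graphs with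
correlation ρ = 1 - c/(D+1), for K = O(D+1) steps. Since A has degree D, it moves little in mean
square at each step. Two consecutive states both lie in G with probability at least p², so the
kernel restricted to pairs in G on which A moves little has mass at least p²/2. Repeated
Cauchy–Schwarz (`pow_le_sum_pathWeight`, `pow_le_pathProb_stable`) then shows that every state lies
in G and every step is small with probability at least (p²/2)^K = 2^(-o(L²)).

On that event repairing and rounding yield independent sets S_t of size at least (1+ι)L, with few
vertices entering at each step. Let U be the union of the sets recorded so far, and record S_t when
it first has about ιL/4 vertices outside U (`chain_or_indepInside`). Either m sets are added to the
initial one, or for some k < m the set at the end of a block of τ steps still has at least (1+3ι/4)L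
vertices inside U.

Both outcomes have probability 2^(-Ω(L²)) by first moments. The initial set contributes at most
2^(L²/2), up to 2^(O(L)). Each vertex added by an extension has N = 2^L choices but must avoid at
least (1+ι/2)L vertices, so one extension gains 2^(-ι²L²/8), and m ≥ 8/ι² of them gain 2^(-L²). In
the other outcome τ steps have almost refreshed the graph, and independence inside U costs
2^(-(1+ι)L²/2), against only 2^|U| subsets. This contradicts the lower bound 2^(-o(L²)). -/

/-- The sign `1` of `false` and `-1` of `true`. -/
def sgn (b : Bool) : ℝ := if b then -1 else 1

/-- The transition kernel of a correlated pair of uniform bits with correlation `ρ`. -/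
noncomputable def bitKernel (ρ : ℝ) (a b : Bool) : ℝ := (1 + ρ * sgn a * sgn b) / 2

lemma sgn_mul_self (b : Bool) : sgn b * sgn b = 1 := by cases b <;> norm_num [sgn]

lemma bitKernel_nonneg {ρ : ℝ} (h0 : 0 ≤ ρ) (h1 : ρ ≤ 1) (a b : Bool) : 0 ≤ bitKernel ρ a b := by
  cases a <;> cases b <;> simp [bitKernel, sgn] <;> linarith

lemma bitKernel_comm (ρ : ℝ) (a b : Bool) : bitKernel ρ a b = bitKernel ρ b a := by
  simp only [bitKernel]; ring

lemma sum_bitKernel (ρ : ℝ) (a : Bool) : ∑ b, bitKernel ρ a b = 1 := by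
  simp [bitKernel, sgn]; ring

lemma sum_bitKernel_mul_sgn (ρ : ℝ) (a : Bool) :
    ∑ b, bitKernel ρ a b * sgn b = ρ * sgn a := by
  simp [bitKernel, sgn]; ring

/-! ### Walsh analysis of the noise operator on the cube. -/

section Cube

variable {d : Type*} [Fintype d]

/-- The noise kernel on the cube: coordinatewise product of `bitKernel ρ`. -/
noncomputable def noiseKernel (ρ : ℝ) (x y : d → Bool) : ℝ := ∏ i, bitKernel ρ (x i) (y i)

/-- The character (Walsh function) of a set of coordinates. -/
def walsh (I : Finset d) (x : d → Bool) : ℝ := ∏ i ∈ I, sgn (x i)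

lemma noiseKernel_nonneg {ρ : ℝ} (h0 : 0 ≤ ρ) (h1 : ρ ≤ 1) (x y : d → Bool) :
    0 ≤ noiseKernel ρ x y :=
  Finset.prod_nonneg fun _ _ => bitKernel_nonneg h0 h1 _ _

lemma noiseKernel_comm (ρ : ℝ) (x y : d → Bool) : noiseKernel ρ x y = noiseKernel ρ y x :=
  Finset.prod_congr rfl fun _ _ => bitKernel_comm _ _ _

variable [DecidableEq d]

lemma sum_cube_prod (f : d → Bool → ℝ) : ∑ x : d → Bool, ∏ i, f i (x i) = ∏ i, ∑ b, f i b := by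
  rw [Finset.prod_univ_sum, Fintype.piFinset_univ]

lemma walsh_eq_prod (I : Finset d) (x : d → Bool) :
    walsh I x = ∏ i, if i ∈ I then sgn (x i) else 1 := by
  simp [walsh, Finset.prod_ite_mem]

/-- Both factors split over coordinates; each coordinate of `J` contributes an eigenvalue `ρ`, every
other one contributes 1. -/
lemma sum_noiseKernel_mul_walsh (ρ : ℝ) (J : Finset d) (x : d → Bool) :
    ∑ y, noiseKernel ρ x y * walsh J y = ρ ^ J.card * walsh J x := by
  simp only [noiseKernel, walsh_eq_prod, ← Finset.prod_mul_distrib]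
  rw [sum_cube_prod fun i b => bitKernel ρ (x i) b * if i ∈ J then sgn b else 1]
  have : ∀ i, ∑ b, bitKernel ρ (x i) b * (if i ∈ J then sgn b else 1)
      = (if i ∈ J then ρ else 1) * if i ∈ J then sgn (x i) else 1 := by
    intro i
    split_ifs
    · exact sum_bitKernel_mul_sgn _ _
    · simp only [mul_one]; exact sum_bitKernel _ _
  simp only [this, Finset.prod_mul_distrib]
  congr 1
  simp [Finset.prod_ite_mem]

lemma sum_noiseKernel (ρ : ℝ) (x : d → Bool) : ∑ y, noiseKernel ρ x y = 1 := by
  simpa [walsh] using sum_noiseKernel_mul_walsh ρ ∅ x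

lemma sum_walsh_mul_walsh (I J : Finset d) :
    ∑ x, walsh I x * walsh J x = if I = J then (2 : ℝ) ^ Fintype.card d else 0 := by
  simp only [walsh_eq_prod, ← Finset.prod_mul_distrib]
  rw [sum_cube_prod fun i b => (if i ∈ I then sgn b else 1) * if i ∈ J then sgn b else 1]
  split_ifs with h
  · subst h
    rw [Finset.prod_congr rfl (g := fun _ => (2 : ℝ))]
    · simp
    · intro i _
      split_ifs <;> norm_num [sgn]
  · obtain ⟨i, hi⟩ : ∃ i, ¬ (i ∈ I ↔ i ∈ J) := by
      by_contra! hc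
      exact h (Finset.ext fun i => by simpa using hc i)
    apply Finset.prod_eq_zero (Finset.mem_univ i)
    by_cases h1 : i ∈ I <;> by_cases h2 : i ∈ J <;> simp_all [sgn]

lemma exists_walsh_expansion {D : ℕ} {f : (d → Bool) → ℝ} (hf : f ∈ degreeFunctions d Bool D) :
    ∃ a : Finset d → ℝ, (∀ I, D < I.card → a I = 0) ∧ ∀ x, f x = ∑ I, a I * walsh I x := by
  induction hf using Submodule.span_induction with
  | mem g hg =>
    obtain ⟨I, f, hI, rfl⟩ := hg
    -- Each factor `f i` is affine in `sgn`; expanding the product over `I` gives these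
    -- coefficients.
    refine ⟨fun J => if J ⊆ I then (∏ i ∈ J, (f i false - f i true) / 2) *
      ∏ i ∈ I \ J, (f i false + f i true) / 2 else 0, ?_, ?_⟩
    · intro J hJ
      refine if_neg fun h => ?_
      exact absurd (Finset.card_le_card h) (by omega)
    · intro x
      have : ∀ i, f i (x i) = (f i false - f i true) / 2 * sgn (x i) +
          (f i false + f i true) / 2 := by
        intro i
        cases x i <;> simp [sgn] <;> ring
      simp only [this]
      rw [Finset.prod_add]
      rw [← Finset.sum_subset (Finset.subset_univ I.powerset)]
      · refine Finset.sum_congr rfl fun J hJ => ?_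
        rw [if_pos (Finset.mem_powerset.1 hJ), Finset.prod_mul_distrib, walsh]
        ring
      · intro J _ hJ
        rw [if_neg (by simpa using hJ), zero_mul]
  | zero => exact ⟨0, by simp, by simp⟩
  | add f g _ _ hf hg =>
    obtain ⟨a, ha, hfa⟩ := hf
    obtain ⟨b, hb, hgb⟩ := hg
    refine ⟨a + b, fun I hI => by simp [ha I hI, hb I hI], fun x => ?_⟩
    simp [hfa, hgb, add_mul, Finset.sum_add_distrib]
  | smul c f _ hf =>
    obtain ⟨a, ha, hfa⟩ := hf
    refine ⟨c • a, fun I hI => by simp [ha I hI], fun x => ?_⟩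
    simp [hfa, Finset.mul_sum, mul_assoc]

lemma mem_degreeFunctions_card (f : (d → Bool) → ℝ) :
    f ∈ degreeFunctions d Bool (Fintype.card d) := by
  have : f = ∑ z, f z • fun y : d → Bool => ∏ i, if y i = z i then (1 : ℝ) else 0 := by
    funext y
    rw [Finset.sum_apply, Finset.sum_eq_single y]
    · simp
    · intro z _ hz
      obtain ⟨i, hi⟩ := Function.ne_iff.1 hz
      simp only [Pi.smul_apply, smul_eq_mul]
      rw [Finset.prod_eq_zero (Finset.mem_univ i) (if_neg (Ne.symm hi)), mul_zero]
    · simp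
  rw [this]
  refine Submodule.sum_mem _ fun z _ => Submodule.smul_mem _ _ (Submodule.subset_span ?_)
  exact ⟨Finset.univ, fun i b => if b = z i then 1 else 0, by simp, rfl⟩

/-- Parseval with a Fourier multiplier `c`; it is used with `c = 1` and with the noise eigenvalues.
-/
lemma sum_sq_walsh_expansion {f : (d → Bool) → ℝ} {a : Finset d → ℝ}
    (hf : ∀ x, f x = ∑ I, a I * walsh I x) (c : Finset d → ℝ) :
    ∑ x, f x * ∑ I, c I * a I * walsh I x = 2 ^ Fintype.card d * ∑ I, c I * a I ^ 2 := by
  calc ∑ x, f x * ∑ I, c I * a I * walsh I x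
      = ∑ I, ∑ J, c I * a I * a J * ∑ x, walsh I x * walsh J x := by
        simp only [hf, Finset.mul_sum, Finset.sum_mul]
        rw [Finset.sum_comm]
        refine Finset.sum_congr rfl fun I _ => ?_
        rw [Finset.sum_comm]
        refine Finset.sum_congr rfl fun J _ => Finset.sum_congr rfl fun x _ => ?_
        ring
    _ = _ := by
        simp only [sum_walsh_mul_walsh, mul_ite, mul_zero, Finset.sum_ite_eq, Finset.mem_univ,
          if_true, Finset.mul_sum]
        refine Finset.sum_congr rfl fun I _ => ?_
        ring

lemma sum_noiseKernel_mul {f : (d → Bool) → ℝ} {a : Finset d → ℝ}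
    (hf : ∀ x, f x = ∑ I, a I * walsh I x) (ρ : ℝ) :
    ∑ x, ∑ y, noiseKernel ρ x y * (f x * f y)
      = 2 ^ Fintype.card d * ∑ I, ρ ^ I.card * a I ^ 2 := by
  rw [← sum_sq_walsh_expansion hf]
  refine Finset.sum_congr rfl fun x _ => ?_
  have : ∑ I, ρ ^ I.card * a I * walsh I x = ∑ y, noiseKernel ρ x y * f y := by
    simp only [hf, Finset.mul_sum]
    rw [Finset.sum_comm]
    refine Finset.sum_congr rfl fun I _ => ?_
    calc _ = a I * (ρ ^ I.card * walsh I x) := by ring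
      _ = _ := by
        rw [← sum_noiseKernel_mul_walsh, Finset.mul_sum]
        refine Finset.sum_congr rfl fun y _ => ?_
        ring
  rw [this, Finset.mul_sum]
  refine Finset.sum_congr rfl fun y _ => ?_
  ring

/-- Low degree functions are stable under noise. -/
theorem noise_stability {D : ℕ} {f : (d → Bool) → ℝ} (hf : f ∈ degreeFunctions d Bool D)
    {ρ : ℝ} (h0 : 0 ≤ ρ) (h1 : ρ ≤ 1) :
    ∑ x, ∑ y, noiseKernel ρ x y * (f x - f y) ^ 2 ≤ 2 * (1 - ρ ^ D) * ∑ x, f x ^ 2 := by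
  obtain ⟨a, ha, hfa⟩ := exists_walsh_expansion hf
  have e1 : ∑ x, f x ^ 2 = 2 ^ Fintype.card d * ∑ I, a I ^ 2 := by
    have := sum_sq_walsh_expansion hfa 1
    simp only [Pi.one_apply, one_mul, ← hfa] at this
    rw [← this]
    exact Finset.sum_congr rfl fun x _ => by ring
  have e2 : ∑ x, ∑ y, noiseKernel ρ x y * (f x - f y) ^ 2
      = 2 * ∑ x, f x ^ 2 - 2 * ∑ x, ∑ y, noiseKernel ρ x y * (f x * f y) := by
    have t1 : ∑ x, ∑ y, noiseKernel ρ x y * f x ^ 2 = ∑ x, f x ^ 2 := by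
      refine Finset.sum_congr rfl fun x _ => ?_
      rw [← Finset.sum_mul, sum_noiseKernel, one_mul]
    have t2 : ∑ x, ∑ y, noiseKernel ρ x y * f y ^ 2 = ∑ x, f x ^ 2 := by
      rw [Finset.sum_comm, ← t1]
      exact Finset.sum_congr rfl fun x _ => Finset.sum_congr rfl fun y _ => by
        rw [noiseKernel_comm]
    have : ∀ x y, noiseKernel ρ x y * (f x - f y) ^ 2 = noiseKernel ρ x y * f x ^ 2 +
        noiseKernel ρ x y * f y ^ 2 - 2 * (noiseKernel ρ x y * (f x * f y)) := by
      intro x y; ring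
    simp only [this, Finset.sum_add_distrib, Finset.sum_sub_distrib, ← Finset.mul_sum, t1, t2]
    ring
  -- Only levels up to `D` carry weight, and there the eigenvalue is at least `ρ ^ D`.
  have key : ρ ^ D * ∑ I, a I ^ 2 ≤ ∑ I, ρ ^ I.card * a I ^ 2 := by
    rw [Finset.mul_sum]
    refine Finset.sum_le_sum fun I _ => ?_
    by_cases hI : D < I.card
    · simp [ha I hI]
    · exact mul_le_mul_of_nonneg_right (pow_le_pow_of_le_one h0 h1 (by omega)) (sq_nonneg _)
  rw [e2, e1, sum_noiseKernel_mul hfa]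
  have h2 : (0 : ℝ) < 2 ^ Fintype.card d := by positivity
  nlinarith [mul_le_mul_of_nonneg_left key h2.le]

/-- The noise kernel is positively correlated. -/
theorem sq_sum_le_noise (g : (d → Bool) → ℝ) {ρ : ℝ} (h0 : 0 ≤ ρ) :
    (∑ x, g x) ^ 2 ≤ 2 ^ Fintype.card d * ∑ x, ∑ y, noiseKernel ρ x y * (g x * g y) := by
  obtain ⟨a, -, hga⟩ := exists_walsh_expansion (mem_degreeFunctions_card g)
  have e1 : ∑ x, g x = 2 ^ Fintype.card d * a ∅ := by
    have hw : ∀ x : d → Bool, walsh ∅ x = 1 := by simp [walsh]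
    calc ∑ x, g x = ∑ I, a I * ∑ x, walsh ∅ x * walsh I x := by
          simp only [hga, hw, one_mul, Finset.mul_sum]
          rw [Finset.sum_comm]
      _ = _ := by simp [sum_walsh_mul_walsh, mul_comm]
  rw [sum_noiseKernel_mul hga, e1, mul_pow, sq, mul_assoc]
  refine mul_le_mul_of_nonneg_left (mul_le_mul_of_nonneg_left ?_ (by positivity)) (by positivity)
  -- All eigenvalues are nonnegative, so keeping only the constant mode gives a lower bound.
  calc a ∅ ^ 2 = ρ ^ (∅ : Finset d).card * a ∅ ^ 2 := by simp
    _ ≤ _ := Finset.single_le_sum (f := fun I : Finset d => ρ ^ I.card * a I ^ 2)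
      (fun I _ => by positivity) (Finset.mem_univ _)

end Cube

/-! ### Weighted path counts of a symmetric kernel. -/

section Paths

variable {X : Type*}

/-- The product of the entries of `M` along a path of length `K`. -/
def pathWeight (M : X → X → ℝ) {K : ℕ} (x : Fin (K + 1) → X) : ℝ :=
  ∏ k : Fin K, M (x k.castSucc) (x k.succ)

lemma pathWeight_nonneg {M : X → X → ℝ} (hM : ∀ a b, 0 ≤ M a b) {K : ℕ} (x : Fin (K + 1) → X) :
    0 ≤ pathWeight M x :=
  Finset.prod_nonneg fun _ _ => hM _ _

lemma pathWeight_snoc (M : X → X → ℝ) {K : ℕ} (x : Fin (K + 1) → X) (a : X) :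
    pathWeight M (Fin.snoc x a : Fin (K + 2) → X) = pathWeight M x * M (x (Fin.last K)) a := by
  simp only [pathWeight]
  rw [Fin.prod_univ_castSucc]
  congr 1
  · refine Finset.prod_congr rfl fun k _ => ?_
    rw [Fin.snoc_castSucc, ← Fin.castSucc_succ, Fin.snoc_castSucc]
  · rw [Fin.snoc_castSucc, Fin.succ_last, Fin.snoc_last]

variable [Fintype X]

lemma sum_path_succ {K : ℕ} (f : (Fin (K + 2) → X) → ℝ) :
    ∑ x, f x = ∑ x : Fin (K + 1) → X, ∑ a, f (Fin.snoc x a) := by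
  rw [← (Fin.snocEquiv fun _ : Fin (K + 2) => X).sum_comp, Fintype.sum_prod_type,
    Finset.sum_comm]
  rfl

lemma sum_pathWeight_mul_last [DecidableEq X] (M : X → X → ℝ) (K : ℕ) (g : X → ℝ) :
    ∑ x : Fin (K + 1) → X, pathWeight M x * g (x (Fin.last K))
      = ∑ a, ∑ b, ((Matrix.of M) ^ K) a b * g b := by
  induction K generalizing g with
  | zero =>
    simp only [pathWeight, Finset.univ_eq_empty, Finset.prod_empty, one_mul, pow_zero,
      Matrix.one_apply, ite_mul, zero_mul, Finset.sum_ite_eq, Finset.mem_univ, if_true]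
    exact (Equiv.funUnique (Fin 1) X).sum_comp g
  | succ K ih =>
    rw [sum_path_succ]
    simp only [pathWeight_snoc, Fin.snoc_last, mul_assoc, ← Finset.mul_sum]
    rw [ih fun b => ∑ a, M b a * g a]
    refine Finset.sum_congr rfl fun a _ => ?_
    simp only [pow_succ, Matrix.mul_apply, Finset.sum_mul, Finset.mul_sum, Matrix.of_apply]
    rw [Finset.sum_comm]
    exact Finset.sum_congr rfl fun b _ => Finset.sum_congr rfl fun c _ => by ring

/-- Weighted path counts of a symmetric matrix: the Sidorenko property of paths whose length is a
power of two. -/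
theorem pow_le_sum_pathWeight [Nonempty X] {M : X → X → ℝ} (hM : ∀ a b, 0 ≤ M a b)
    (hs : ∀ a b, M a b = M b a) (j : ℕ) :
    ((∑ a, ∑ b, M a b) / Fintype.card X) ^ 2 ^ j ≤
      (∑ x : Fin (2 ^ j + 1) → X, pathWeight M x) / Fintype.card X := by
  classical
  have hc : (0 : ℝ) < Fintype.card X := by exact_mod_cast Fintype.card_pos
  have key : ∀ j : ℕ, ((∑ a, ∑ b, M a b) / Fintype.card X) ^ 2 ^ j ≤
      (∑ a, ∑ b, ((Matrix.of M) ^ 2 ^ j) a b) / Fintype.card X := by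
    intro j
    induction j with
    | zero => simp
    | succ j ih =>
      have hsym : ((Matrix.of M) ^ 2 ^ j).transpose = (Matrix.of M) ^ 2 ^ j := by
        rw [Matrix.transpose_pow]
        congr 1
        ext a b
        exact hs b a
      set Q := (Matrix.of M) ^ 2 ^ j with hQ
      -- By symmetry the total mass of `Q ^ 2` is the squared norm of the row-sum vector of `Q`;
      -- Cauchy–Schwarz then drives the doubling of the length.
      have e : ∑ a, ∑ b, ((Matrix.of M) ^ 2 ^ (j + 1)) a b = ∑ c, (∑ b, Q c b) ^ 2 := by
        rw [pow_succ, pow_mul, ← hQ, sq]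
        simp only [Matrix.mul_apply]
        calc _ = ∑ a, ∑ c, ∑ b, Q a c * Q c b :=
              Finset.sum_congr rfl fun a _ => Finset.sum_comm
          _ = ∑ c, ∑ a, ∑ b, Q a c * Q c b := Finset.sum_comm
          _ = _ := by
            refine Finset.sum_congr rfl fun c _ => ?_
            rw [sq, Finset.sum_mul_sum]
            refine Finset.sum_congr rfl fun a _ => Finset.sum_congr rfl fun b _ => ?_
            congr 1
            exact congrFun (congrFun hsym c) a
      have h0 : 0 ≤ (∑ a, ∑ b, M a b) / (Fintype.card X : ℝ) :=
        div_nonneg (Finset.sum_nonneg fun a _ => Finset.sum_nonneg fun b _ => hM a b) hc.le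
      have cs : (∑ c, ∑ b, Q c b) ^ 2 ≤ Fintype.card X * ∑ c, (∑ b, Q c b) ^ 2 := by
        have := sq_sum_le_card_mul_sum_sq (s := (Finset.univ : Finset X))
          (f := fun c => ∑ b, Q c b)
        simpa using this
      rw [e, pow_succ, pow_mul]
      calc _ ≤ ((∑ a, ∑ b, Q a b) / (Fintype.card X : ℝ)) ^ 2 :=
            pow_le_pow_left₀ (pow_nonneg h0 _) ih 2
        _ ≤ _ := by
          rw [div_pow, div_le_div_iff₀ (by positivity) hc]
          nlinarith [mul_le_mul_of_nonneg_right cs hc.le]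
  refine (key j).trans_eq ?_
  congr 1
  simpa using (sum_pathWeight_mul_last M (2 ^ j) fun _ => 1).symm

end Paths

/-! ### Correlations along a single noisy bit. -/

section BitPaths

/-- The kernel is stochastic, so a final step that is not observed can be summed out. -/
lemma sum_bitPath_succ (ρ : ℝ) {K : ℕ} (f : (Fin (K + 1) → Bool) → ℝ) :
    ∑ x : Fin (K + 2) → Bool, pathWeight (bitKernel ρ) x * f (Fin.init x)
      = ∑ x, pathWeight (bitKernel ρ) x * f x := by
  rw [sum_path_succ]
  simp only [pathWeight_snoc, Fin.init_snoc]
  refine Finset.sum_congr rfl fun x _ => ?_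
  rw [← Finset.sum_mul, ← Finset.mul_sum, sum_bitKernel, mul_one]

lemma sum_bitPath_succ_mul_sgn (ρ : ℝ) {K : ℕ} (f : (Fin (K + 1) → Bool) → ℝ) :
    ∑ x : Fin (K + 2) → Bool,
        pathWeight (bitKernel ρ) x * (f (Fin.init x) * sgn (x (Fin.last (K + 1))))
      = ρ * ∑ x, pathWeight (bitKernel ρ) x * (f x * sgn (x (Fin.last K))) := by
  rw [sum_path_succ]
  simp only [pathWeight_snoc, Fin.init_snoc, Fin.snoc_last, Finset.mul_sum (a := ρ)]
  refine Finset.sum_congr rfl fun x _ => ?_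
  calc _ = pathWeight (bitKernel ρ) x * f x *
        ∑ b, bitKernel ρ (x (Fin.last K)) b * sgn b := by
        rw [Finset.mul_sum]
        exact Finset.sum_congr rfl fun b _ => by ring
    _ = _ := by rw [sum_bitKernel_mul_sgn]; ring

lemma sum_bitPath (ρ : ℝ) (K : ℕ) :
    ∑ x : Fin (K + 1) → Bool, pathWeight (bitKernel ρ) x = 2 := by
  induction K with
  | zero => simp [pathWeight]
  | succ K ih => simpa [ih] using sum_bitPath_succ ρ (K := K) fun _ => 1

lemma sum_bitPath_mul_sgn (ρ : ℝ) (K : ℕ) (t : Fin (K + 1)) :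
    ∑ x : Fin (K + 1) → Bool, pathWeight (bitKernel ρ) x * sgn (x t) = 0 := by
  induction K with
  | zero =>
    rw [Fin.fin_one_eq_zero t, ← (Equiv.funUnique (Fin 1) Bool).symm.sum_comp]
    simp [pathWeight, sgn]
  | succ K ih =>
    induction t using Fin.lastCases with
    | last =>
      have := sum_bitPath_succ_mul_sgn ρ (K := K) fun _ => 1
      simp only [one_mul] at this
      rw [this, ih, mul_zero]
    | cast t => rw [← ih t]; exact sum_bitPath_succ ρ (K := K) fun x => sgn (x t)

lemma sum_bitPath_mul_sgn_mul_sgn (ρ : ℝ) (K : ℕ) (s t : Fin (K + 1)) (hst : s ≤ t) :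
    ∑ x : Fin (K + 1) → Bool, pathWeight (bitKernel ρ) x * (sgn (x s) * sgn (x t))
      = 2 * ρ ^ ((t : ℕ) - s) := by
  induction K with
  | zero =>
    rw [Fin.fin_one_eq_zero t, Fin.fin_one_eq_zero s]
    simp [sgn_mul_self, sum_bitPath]
  | succ K ih =>
    induction t using Fin.lastCases with
    | last =>
      induction s using Fin.lastCases with
      | last => simp [sgn_mul_self, sum_bitPath]
      | cast s =>
        have := sum_bitPath_succ_mul_sgn ρ (K := K) fun x => sgn (x s)
        refine this.trans ?_
        rw [ih s (Fin.last K) (Fin.le_last s)]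
        have h : (Fin.last (K + 1) : ℕ) - (s.castSucc : ℕ) = (Fin.last K : ℕ) - s + 1 := by
          have := s.2
          simp only [Fin.val_last, Fin.val_castSucc]
          omega
        rw [h, pow_succ]
        ring
    | cast t =>
      induction s using Fin.lastCases with
      | last => exact absurd hst (not_le.2 (Fin.castSucc_lt_last t))
      | cast s =>
        rw [Fin.val_castSucc, Fin.val_castSucc, ← ih s t hst]
        exact sum_bitPath_succ ρ (K := K) fun x => sgn (x s) * sgn (x t)

lemma ite_eq_false_eq (b : Bool) : (if b = false then (1 : ℝ) else 0) = (1 + sgn b) / 2 := by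
  cases b <;> norm_num [sgn]

lemma sum_bitPath_false (ρ : ℝ) (K : ℕ) (t : Fin (K + 1)) :
    ∑ x : Fin (K + 1) → Bool,
      pathWeight (bitKernel ρ) x * (if x t = false then 1 else 0) = 1 := by
  simp only [ite_eq_false_eq]
  have : ∀ x : Fin (K + 1) → Bool, pathWeight (bitKernel ρ) x * ((1 + sgn (x t)) / 2)
      = (pathWeight (bitKernel ρ) x + pathWeight (bitKernel ρ) x * sgn (x t)) / 2 := by
    intro x; ring
  simp only [this, ← Finset.sum_div, Finset.sum_add_distrib, sum_bitPath, sum_bitPath_mul_sgn]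
  norm_num

lemma sum_bitPath_false_false (ρ : ℝ) (K : ℕ) (s t : Fin (K + 1)) (hst : s ≤ t) :
    ∑ x : Fin (K + 1) → Bool, pathWeight (bitKernel ρ) x *
      ((if x s = false then 1 else 0) * (if x t = false then 1 else 0))
      = (1 + ρ ^ ((t : ℕ) - s)) / 2 := by
  simp only [ite_eq_false_eq]
  have : ∀ x : Fin (K + 1) → Bool,
      pathWeight (bitKernel ρ) x * ((1 + sgn (x s)) / 2 * ((1 + sgn (x t)) / 2))
      = (pathWeight (bitKernel ρ) x + pathWeight (bitKernel ρ) x * sgn (x s) +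
        pathWeight (bitKernel ρ) x * sgn (x t) +
        pathWeight (bitKernel ρ) x * (sgn (x s) * sgn (x t))) / 4 := by
    intro x; ring
  simp only [this, ← Finset.sum_div, Finset.sum_add_distrib, sum_bitPath, sum_bitPath_mul_sgn,
    sum_bitPath_mul_sgn_mul_sgn ρ K s t hst]
  ring

end BitPaths

/-! ### The stationary noise chain on the cube. -/

section PathProb

variable {d : Type*} [Fintype d] [DecidableEq d]

open Classical in
/-- The probability of an event for the stationary noise chain of length `K` on the cube. -/
noncomputable def pathProb (d : Type*) [Fintype d] [DecidableEq d] (ρ : ℝ) (K : ℕ)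
    (Q : (Fin (K + 1) → d → Bool) → Prop) : ℝ :=
  (∑ x : Fin (K + 1) → d → Bool, pathWeight (noiseKernel ρ) x * if Q x then 1 else 0) /
    2 ^ Fintype.card d

variable {ρ : ℝ} {K : ℕ}

lemma pathProb_mono (h0 : 0 ≤ ρ) (h1 : ρ ≤ 1) {Q R : (Fin (K + 1) → d → Bool) → Prop}
    (h : ∀ x, Q x → R x) : pathProb d ρ K Q ≤ pathProb d ρ K R := by
  classical
  unfold pathProb
  refine div_le_div_of_nonneg_right (Finset.sum_le_sum fun x _ => ?_) (by positivity)
  refine mul_le_mul_of_nonneg_left ?_ (pathWeight_nonneg (fun a b => noiseKernel_nonneg h0 h1 a b) x)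
  split_ifs with hQ hR hR
  · exact le_rfl
  · exact absurd (h x hQ) hR
  · exact zero_le_one
  · exact le_rfl

lemma pathProb_exists_le (h0 : 0 ≤ ρ) (h1 : ρ ≤ 1) {α : Type*} (s : Finset α)
    (Q : α → (Fin (K + 1) → d → Bool) → Prop) :
    pathProb d ρ K (fun x => ∃ a ∈ s, Q a x) ≤ ∑ a ∈ s, pathProb d ρ K (Q a) := by
  classical
  unfold pathProb
  rw [← Finset.sum_div, Finset.sum_comm]
  refine div_le_div_of_nonneg_right (Finset.sum_le_sum fun x _ => ?_) (by positivity)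
  rw [← Finset.mul_sum]
  refine mul_le_mul_of_nonneg_left ?_ (pathWeight_nonneg (fun a b => noiseKernel_nonneg h0 h1 a b) x)
  split_ifs with h
  · obtain ⟨a, ha, hQ⟩ := h
    calc (1 : ℝ) = if Q a x then 1 else 0 := by rw [if_pos hQ]
      _ ≤ _ := Finset.single_le_sum (f := fun a => if Q a x then (1 : ℝ) else 0)
        (fun b _ => by split_ifs <;> norm_num) ha
  · exact Finset.sum_nonneg fun b _ => by split_ifs <;> norm_num

lemma pathProb_or_le (h0 : 0 ≤ ρ) (h1 : ρ ≤ 1) (Q R : (Fin (K + 1) → d → Bool) → Prop) :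
    pathProb d ρ K (fun x => Q x ∨ R x) ≤ pathProb d ρ K Q + pathProb d ρ K R := by
  have := pathProb_exists_le h0 h1 (Finset.univ : Finset Bool) fun b => if b then R else Q
  simpa [add_comm] using this

/-- The coordinates of the noise chain evolve independently. -/
lemma sum_noisePath_prod (c : d → (Fin (K + 1) → Bool) → ℝ) :
    ∑ x : Fin (K + 1) → d → Bool, pathWeight (noiseKernel ρ) x * ∏ e, c e (fun k => x k e)
      = ∏ e, ∑ p : Fin (K + 1) → Bool, pathWeight (bitKernel ρ) p * c e p := by
  rw [Finset.prod_univ_sum, Fintype.piFinset_univ,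
    ← (Equiv.piComm fun (_ : Fin (K + 1)) (_ : d) => Bool).sum_comp]
  refine Finset.sum_congr rfl fun x _ => ?_
  rw [Finset.prod_mul_distrib]
  congr 1
  simp only [pathWeight, noiseKernel]
  rw [Finset.prod_comm]
  rfl

/-- The probability that all coordinates in `R` vanish at prescribed times and all coordinates in
`W` vanish at a later time. -/
theorem pathProb_false_le (h0 : 0 ≤ ρ) (h1 : ρ ≤ 1) (R W : Finset d) (tm : d → Fin (K + 1))
    (t : Fin (K + 1)) (τ : ℕ) (htm : ∀ e ∈ R, e ∈ W → (tm e : ℕ) + τ ≤ t) :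
    pathProb d ρ K (fun x => (∀ e ∈ R, x (tm e) e = false) ∧ ∀ e ∈ W, x t e = false) ≤
      (1 / 2) ^ R.card * ((1 + ρ ^ τ) / 2) ^ W.card := by
  classical
  let c : d → (Fin (K + 1) → Bool) → ℝ := fun e p =>
    (if e ∈ R then if p (tm e) = false then 1 else 0 else 1) *
      (if e ∈ W then if p t = false then 1 else 0 else 1)
  have hc : ∀ x : Fin (K + 1) → d → Bool,
      (if (∀ e ∈ R, x (tm e) e = false) ∧ ∀ e ∈ W, x t e = false then (1 : ℝ) else 0)
        = ∏ e, c e (fun k => x k e) := by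
    intro x
    split_ifs with h
    · symm
      refine Finset.prod_eq_one fun e _ => ?_
      simp only [c]
      split_ifs <;> simp_all
    · rw [not_and_or] at h
      push Not at h
      symm
      rcases h with ⟨e, he, h⟩ | ⟨e, he, h⟩
      · refine Finset.prod_eq_zero (Finset.mem_univ e) ?_
        simp [c, he, h]
      · refine Finset.prod_eq_zero (Finset.mem_univ e) ?_
        simp [c, he, h]
  have hp : pathProb d ρ K (fun x => (∀ e ∈ R, x (tm e) e = false) ∧ ∀ e ∈ W, x t e = false)
      = (∑ x : Fin (K + 1) → d → Bool,
        pathWeight (noiseKernel ρ) x * ∏ e, c e (fun k => x k e)) / 2 ^ Fintype.card d := by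
    unfold pathProb
    congr 1
    refine Finset.sum_congr rfl fun x _ => ?_
    rw [← hc]
    congr
  rw [hp, sum_noisePath_prod c, ← Finset.card_univ, ← Finset.prod_const, ← Finset.prod_div_distrib]
  have hR : ((1 : ℝ) / 2) ^ R.card = ∏ e, if e ∈ R then 1 / 2 else 1 := by
    simp [Finset.prod_ite_mem]
  have hW : ((1 + ρ ^ τ) / 2) ^ W.card = ∏ e, if e ∈ W then (1 + ρ ^ τ) / 2 else 1 := by
    simp [Finset.prod_ite_mem, div_pow]
  rw [hR, hW, ← Finset.prod_mul_distrib]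
  refine Finset.prod_le_prod (fun e _ => ?_) (fun e _ => ?_)
  · refine div_nonneg (Finset.sum_nonneg fun p _ => mul_nonneg
      (pathWeight_nonneg (fun a b => bitKernel_nonneg h0 h1 a b) p) ?_) zero_le_two
    simp only [c]
    split_ifs <;> norm_num
  -- A coordinate in both sets is absent at two times at least `τ` apart, with probability at most
  -- (1/2)(1+ρ^τ)/2. A coordinate in `W` alone contributes 1/2, which is below the claimed factor.
  · have hp : 0 ≤ ρ ^ τ := pow_nonneg h0 _
    by_cases hR : e ∈ R <;> by_cases hW : e ∈ W
    · simp only [c, hR, hW, if_true]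
      have hle := htm e hR hW
      rw [sum_bitPath_false_false ρ K (tm e) t (Fin.le_def.2 (by omega))]
      have : ρ ^ ((t : ℕ) - tm e) ≤ ρ ^ τ := pow_le_pow_of_le_one h0 h1 (by omega)
      linarith
    · simp only [c, hR, hW, if_true, if_false, mul_one]
      rw [sum_bitPath_false]
    · simp only [c, hR, hW, if_true, if_false, one_mul]
      rw [sum_bitPath_false]
      linarith
    · simp only [c, hR, hW, if_false, mul_one]
      rw [sum_bitPath]
      norm_num

end PathProb

/-! ### Pairs of vertices inside a set. -/

section Pairs

variable {N : ℕ}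

/-- The pairs of vertices contained in `S`. -/
def pairsIn (S : Finset (Fin N)) : Finset (Pair N) :=
  Finset.univ.filter fun e => ∀ v ∈ e.1, v ∈ S

lemma mem_pairsIn {S : Finset (Fin N)} {e : Pair N} :
    e ∈ pairsIn S ↔ ∀ v ∈ e.1, v ∈ S := by
  simp [pairsIn]

lemma pairsIn_mono {S T : Finset (Fin N)} (h : S ⊆ T) : pairsIn S ⊆ pairsIn T := fun _ he =>
  mem_pairsIn.2 fun v hv => h (mem_pairsIn.1 he v hv)

lemma eq_false_of_isIndepSet {y : Input N} {S : Finset (Fin N)}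
    (h : (graph y).IsIndepSet (S : Set (Fin N))) {e : Pair N} (he : e ∈ pairsIn S) :
    y e = false := by
  obtain ⟨e, hd⟩ := e
  induction e using Sym2.ind with
  | _ u v =>
    have hu : u ∈ S := mem_pairsIn.1 he u (by simp)
    have hv : v ∈ S := mem_pairsIn.1 he v (by simp)
    have huv : u ≠ v := by simpa using hd
    have := h (Finset.mem_coe.2 hu) (Finset.mem_coe.2 hv) huv
    by_contra hy
    refine this ?_
    simp only [graph, SimpleGraph.fromEdgeSet_adj, Set.mem_ofPred_eq]
    exact ⟨⟨hd, by simpa using hy⟩, huv⟩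

lemma card_pairsIn (S : Finset (Fin N)) : (pairsIn S).card = S.card.choose 2 := by
  rw [← Sym2.card_image_offDiag, ← Finset.card_map (Function.Embedding.subtype _)]
  congr 1
  ext e
  induction e using Sym2.ind with
  | _ u v =>
    simp only [Finset.mem_map, Finset.mem_image, Finset.mem_offDiag, Prod.exists,
      Function.Embedding.subtype_apply]
    constructor
    · rintro ⟨e, he, hee⟩
      have hd := e.2
      rw [mem_pairsIn] at he
      rw [hee] at hd he
      exact ⟨u, v, ⟨he u (by simp), he v (by simp), by simpa using hd⟩, rfl⟩
    · rintro ⟨a, b, ⟨ha, hb, hab⟩, h⟩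
      rw [← h]
      refine ⟨⟨s(a, b), by simpa using hab⟩, mem_pairsIn.2 ?_, rfl⟩
      intro w hw
      rcases Sym2.mem_iff.1 hw with rfl | rfl <;> assumption

/-- Pairs joining a new vertex of `S` to an old one are not inside `U`, so their absence is a fresh
constraint. -/
lemma card_mul_card_le_card_pairsIn_sdiff (U S : Finset (Fin N)) :
    (S \ U).card * (S ∩ U).card ≤ (pairsIn S \ pairsIn U).card := by
  rw [← Finset.card_product,
    ← Finset.card_map (Function.Embedding.subtype fun e : Sym2 (Fin N) => ¬ e.IsDiag)]
  refine Finset.card_le_card_of_injOn (fun p => s(p.1, p.2)) ?_ ?_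
  · rintro ⟨a, b⟩ h
    simp only [Finset.coe_product, Set.mem_prod, Finset.mem_coe, Finset.mem_sdiff,
      Finset.mem_inter] at h
    have hab : a ≠ b := fun hab => h.1.2 (hab ▸ h.2.2)
    refine Finset.mem_coe.2 (Finset.mem_map.2 ⟨⟨s(a, b), by simpa using hab⟩, ?_, rfl⟩)
    refine Finset.mem_sdiff.2 ⟨mem_pairsIn.2 fun w hw => ?_, fun hU => ?_⟩
    · rcases Sym2.mem_iff.1 hw with rfl | rfl
      exacts [h.1.1, h.2.1]
    · exact h.1.2 (mem_pairsIn.1 hU a (by simp))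
  · rintro ⟨a, b⟩ h ⟨a', b'⟩ h' heq
    simp only [Finset.coe_product, Set.mem_prod, Finset.mem_coe, Finset.mem_sdiff,
      Finset.mem_inter] at h h'
    rcases Sym2.eq_iff.1 heq with ⟨rfl, rfl⟩ | ⟨rfl, rfl⟩
    · rfl
    · exact absurd h'.2.2 h.1.2

end Pairs

/-! ### Expected number of extensions of a family of sets. -/

section Extensions

variable {N : ℕ}

/-- A set that is large and meets the complement of `U` in a moderate number of vertices. -/
def Extends (a h s₀ : ℝ) (U S : Finset (Fin N)) : Prop :=
  a ≤ ((S \ U).card : ℝ) ∧ ((S \ U).card : ℝ) ≤ h ∧ s₀ ≤ (S.card : ℝ)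

/-- There are at most `N ^ n` sets of size `n`, so each added vertex costs `N * r ≤ q`. -/
lemma sum_pow_card_le {r a q : ℝ} (hr : 0 ≤ r) (hq0 : 0 < q) (hq : q ≤ 1) (hrq : N * r ≤ q) :
    ∑ B : Finset (Fin N), (if a ≤ (B.card : ℝ) then r ^ B.card else 0)
      ≤ (N + 1) * q ^ a := by
  have h := Finset.sum_powerset_apply_card (fun n : ℕ => if a ≤ (n : ℝ) then r ^ n else 0)
    (x := (Finset.univ : Finset (Fin N)))
  rw [Finset.powerset_univ] at h
  rw [h]
  simp only [Finset.card_univ, Fintype.card_fin]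
  calc _ ≤ ∑ n ∈ Finset.range (N + 1), q ^ a := by
        refine Finset.sum_le_sum fun n _ => ?_
        split_ifs with hn
        · rw [nsmul_eq_mul]
          calc (N.choose n : ℝ) * r ^ n ≤ (N : ℝ) ^ n * r ^ n := by
                refine mul_le_mul_of_nonneg_right ?_ (by positivity)
                exact_mod_cast Nat.choose_le_pow N n
            _ = (N * r) ^ n := (mul_pow _ _ _).symm
            _ ≤ q ^ n := pow_le_pow_left₀ (by positivity) hrq n
            _ = q ^ (n : ℝ) := (Real.rpow_natCast q n).symm
            _ ≤ q ^ a := Real.rpow_le_rpow_of_exponent_ge hq0 hq hn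
        · rw [smul_zero]; positivity
    _ = _ := by simp

/-- The expected number of extensions of a family of sets covered by `U`. -/
lemma sum_extends_le {a h s₀ r q : ℝ} (hr0 : 0 < r) (hq0 : 0 < q) (hq : q ≤ 1)
    (hr : (1 / 2 : ℝ) ^ (s₀ - h) ≤ r) (hrq : N * r ≤ q) (U : Finset (Fin N))
    {R : Finset (Pair N)} (hR : R ⊆ pairsIn U) (s : Finset (Finset (Fin N)))
    (hs : ∀ S ∈ s, Extends a h s₀ U S) :
    ∑ S ∈ s, (1 / 2 : ℝ) ^ (pairsIn S \ R).card
      ≤ 2 ^ U.card * ((N + 1) * q ^ a) := by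
  calc ∑ S ∈ s, (1 / 2 : ℝ) ^ (pairsIn S \ R).card
      ≤ ∑ S ∈ s,
          (if a ≤ ((S \ U).card : ℝ) then r ^ (S \ U).card else 0) := by
        refine Finset.sum_le_sum fun S hS => ?_
        obtain ⟨h1, h2, h3⟩ := hs S hS
        rw [if_pos h1]
        have hcard : ((S \ U).card : ℝ) + (S ∩ U).card = S.card := by
          exact_mod_cast Finset.card_sdiff_add_card_inter S U
        calc (1 / 2 : ℝ) ^ (pairsIn S \ R).card
            ≤ (1 / 2) ^ ((S ∩ U).card * (S \ U).card) := by
              refine pow_le_pow_of_le_one (by norm_num) (by norm_num) ?_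
              rw [mul_comm]
              exact (card_mul_card_le_card_pairsIn_sdiff U S).trans
                (Finset.card_le_card (Finset.sdiff_subset_sdiff subset_rfl hR))
          _ = ((1 / 2) ^ (S ∩ U).card) ^ (S \ U).card := pow_mul _ _ _
          _ ≤ r ^ (S \ U).card := by
              refine pow_le_pow_left₀ (by positivity) (le_trans ?_ hr) _
              rw [← Real.rpow_natCast]
              exact Real.rpow_le_rpow_of_exponent_ge (by norm_num) (by norm_num) (by linarith)
    _ ≤ ∑ p ∈ U.powerset ×ˢ (Finset.univ : Finset (Finset (Fin N))),
          (if a ≤ (p.2.card : ℝ) then r ^ p.2.card else 0) := by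
        -- `S` is determined by its old part, one of `2 ^ U.card` subsets, and its new part, whose
        -- sum is bounded by `sum_pow_card_le`.
        rw [← Finset.sum_image (f := fun p : Finset (Fin N) × Finset (Fin N) =>
          if a ≤ (p.2.card : ℝ) then r ^ p.2.card else 0) (g := fun S => (S ∩ U, S \ U))]
        · refine Finset.sum_le_sum_of_subset_of_nonneg ?_ ?_
          · intro p hp
            obtain ⟨S, -, rfl⟩ := Finset.mem_image.1 hp
            simp
          · intro p _ _
            split_ifs <;> positivity
        · intro S _ T _ hST
          simp only [Prod.mk.injEq] at hST
          rw [← Finset.sdiff_union_inter S U, hST.1, hST.2, Finset.sdiff_union_inter]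
    _ ≤ _ := by
        rw [Finset.sum_product]
        simp only [Finset.sum_const, Finset.card_powerset, nsmul_eq_mul]
        push_cast
        exact mul_le_mul_of_nonneg_left (sum_pow_card_le hr0.le hq0 hq hrq) (by positivity)

end Extensions

/-! ### Chains of extensions and their first moment. -/

section Chains

variable {N K : ℕ}

/-- Starting from a collection of pairs `R`, within the vertex set `U`, prescribed to be absent at
times `tm`, the path `x` of graphs admits `k` successive extensions at times at most `T`, after
which the condition `term` holds. -/
def Chain (a h s₀ : ℝ) (T : ℕ) (term : Finset (Fin N) → (Fin (K + 1) → Input N) → Prop)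
    (x : Fin (K + 1) → Input N) :
    ℕ → Finset (Fin N) → Finset (Pair N) → (Pair N → Fin (K + 1)) → Prop
  | 0, U, R, tm => (∀ e ∈ R, x (tm e) e = false) ∧ term U x
  | k + 1, U, R, tm => ∃ (t : Fin (K + 1)) (S : Finset (Fin N)), (t : ℕ) ≤ T ∧ Extends a h s₀ U S ∧
      Chain a h s₀ T term x k (U ∪ S) (R ∪ pairsIn S) (fun e => if e ∈ R then tm e else t)

/-- Union bound over the time and set of each extension: at most `K + 1` times, and total weight `β`
for the sets. A pair keeps the time at which it was first prescribed, so each pair of `R` is paid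
for by a single factor 1/2. -/
theorem pathProb_chain_le {ρ a h s₀ β γ B : ℝ} (hρ0 : 0 ≤ ρ) (hρ1 : ρ ≤ 1) (hβ : 0 ≤ β)
    (hγ : 0 ≤ γ) (hh : 0 ≤ h) {T : ℕ} {term : Finset (Fin N) → (Fin (K + 1) → Input N) → Prop}
    (hbase : ∀ (U : Finset (Fin N)) (R : Finset (Pair N)) (tm : Pair N → Fin (K + 1)),
      (U.card : ℝ) ≤ B → (∀ e ∈ R, (tm e : ℕ) ≤ T) →
      pathProb (Pair N) ρ K (fun x => (∀ e ∈ R, x (tm e) e = false) ∧ term U x)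
        ≤ γ * (1 / 2) ^ R.card)
    (hstep : ∀ (U : Finset (Fin N)) (R : Finset (Pair N)), (U.card : ℝ) ≤ B → R ⊆ pairsIn U →
      ∀ s : Finset (Finset (Fin N)), (∀ S ∈ s, Extends a h s₀ U S) →
      ∑ S ∈ s, (1 / 2 : ℝ) ^ (pairsIn S \ R).card ≤ β)
    (k : ℕ) (U : Finset (Fin N)) (R : Finset (Pair N)) (tm : Pair N → Fin (K + 1))
    (hU : (U.card : ℝ) + k * h ≤ B) (hR : R ⊆ pairsIn U) (htm : ∀ e ∈ R, (tm e : ℕ) ≤ T) :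
    pathProb (Pair N) ρ K (fun x => Chain a h s₀ T term x k U R tm)
      ≤ ((K + 1) * β) ^ k * γ * (1 / 2) ^ R.card := by
  classical
  induction k generalizing U R tm with
  | zero =>
    simp only [pow_zero, one_mul]
    exact hbase U R tm (by simpa using hU) htm
  | succ k ih =>
    have hUB : (U.card : ℝ) ≤ B := le_trans (le_add_of_nonneg_right (by positivity)) hU
    set s : Finset (Finset (Fin N)) := Finset.univ.filter (Extends a h s₀ U) with hs
    set I : Finset (Fin (K + 1)) := Finset.univ.filter fun t => (t : ℕ) ≤ T
    calc _ ≤ pathProb (Pair N) ρ K (fun x => ∃ p ∈ I ×ˢ s, Chain a h s₀ T term x k (U ∪ p.2)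
            (R ∪ pairsIn p.2) (fun e => if e ∈ R then tm e else p.1)) := by
          refine pathProb_mono hρ0 hρ1 fun x hx => ?_
          obtain ⟨t, S, ht, hS, hx⟩ := hx
          exact ⟨(t, S), by simp [I, s, ht, hS], hx⟩
      _ ≤ ∑ p ∈ I ×ˢ s, ((K + 1) * β) ^ k * γ * (1 / 2) ^ R.card *
            (1 / 2) ^ (pairsIn p.2 \ R).card := by
          refine (pathProb_exists_le hρ0 hρ1 _ _).trans (Finset.sum_le_sum fun p hp => ?_)
          simp only [Finset.mem_product, I, s, Finset.mem_filter, Finset.mem_univ, true_and] at hp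
          refine (ih (U ∪ p.2) (R ∪ pairsIn p.2) (fun e => if e ∈ R then tm e else p.1)
            ?_ ?_ ?_).trans_eq ?_
          · have : ((U ∪ p.2).card : ℝ) = (p.2 \ U).card + U.card := by
              rw [Finset.union_comm]
              exact_mod_cast (Finset.card_sdiff_add_card p.2 U).symm
            rw [this]
            have := hp.2.2.1
            push_cast at hU
            linarith
          · exact Finset.union_subset (hR.trans (pairsIn_mono Finset.subset_union_left))
              (pairsIn_mono Finset.subset_union_right)
          · intro e he
            split_ifs with h
            · exact htm e h
            · exact hp.1
          · rw [mul_assoc _ ((1 / 2 : ℝ) ^ R.card), ← pow_add]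
            congr 2
            rw [Finset.union_comm, ← Finset.card_sdiff_add_card]
            omega
      _ ≤ _ := by
          rw [Finset.sum_product]
          simp only [Finset.sum_const, ← Finset.mul_sum, nsmul_eq_mul, pow_succ]
          have hI : (I.card : ℝ) ≤ K + 1 := by
            exact_mod_cast (Finset.card_le_univ I).trans (by simp)
          have := hstep U R hUB hR s fun S hS => (Finset.mem_filter.1 hS).2
          calc _ ≤ (K + 1 : ℝ) * (((K + 1) * β) ^ k * γ * (1 / 2) ^ R.card * β) := by
                refine mul_le_mul hI (mul_le_mul_of_nonneg_left this (by positivity)) ?_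
                  (by positivity)
                exact mul_nonneg (by positivity) (Finset.sum_nonneg fun _ _ => by positivity)
            _ = _ := by ring

end Chains

/-! ### Full chain or stuck block. -/

section Dichotomy

variable {N K : ℕ}

/-- Some subset of `U` of size at least `w` is independent at time `t`. -/
def IndepInside (w : ℝ) (t : ℕ) (U : Finset (Fin N)) (x : Fin (K + 1) → Input N) : Prop :=
  ∃ (ht : t < K + 1) (W : Finset (Fin N)), W ⊆ U ∧ w ≤ (W.card : ℝ) ∧
    ∀ e ∈ pairsIn W, x ⟨t, ht⟩ e = false

/-- A slowly moving sequence of large independent sets either admits a full chain of extensions, or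
gets stuck, for a whole block of length `τ`, inside the union of a chain. -/
theorem chain_or_indepInside {a δ h s₀ : ℝ} (ha : 0 < a) (hh : a + δ ≤ h) {m τ : ℕ}
    (hK : m * τ ≤ K) (x : Fin (K + 1) → Input N) (S : ℕ → Finset (Fin N))
    (hS : ∀ t (ht : t < K + 1), s₀ ≤ ((S t).card : ℝ) ∧ ∀ e ∈ pairsIn (S t), x ⟨t, ht⟩ e = false)
    (hstep : ∀ t < K, ((S (t + 1) \ S t).card : ℝ) ≤ δ) (r j t₀ : ℕ) (hj : j + r = m)
    (ht₀ : t₀ ≤ j * τ) (U : Finset (Fin N)) (hU : S t₀ ⊆ U) (R : Finset (Pair N))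
    (tm : Pair N → Fin (K + 1)) (hR : ∀ e ∈ R, x (tm e) e = false) :
    Chain a h s₀ K (fun _ _ => True) x r U R tm ∨
      ∃ k, j ≤ k ∧ k < m ∧
        Chain a h s₀ (k * τ) (IndepInside (s₀ - a) ((k + 1) * τ)) x (k - j) U R tm := by
  induction r generalizing j t₀ U R tm with
  | zero => exact Or.inl ⟨hR, trivial⟩
  | succ r ih =>
    have hend : (j + 1) * τ ≤ K := (Nat.mul_le_mul_right τ (by omega)).trans hK
    by_cases hstuck : ((S ((j + 1) * τ) \ U).card : ℝ) < a
    -- Stuck in block `j`: fewer than `a` vertices of the current set lie outside `U`, so at least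
    -- `s₀ - a` lie inside.
    · refine Or.inr ⟨j, le_rfl, by omega, ?_⟩
      rw [Nat.sub_self]
      have hlt : (j + 1) * τ < K + 1 := by omega
      refine ⟨hR, hlt, S ((j + 1) * τ) ∩ U, Finset.inter_subset_right, ?_, ?_⟩
      · have : (((S ((j + 1) * τ)) \ U).card : ℝ) + (S ((j + 1) * τ) ∩ U).card
            = (S ((j + 1) * τ)).card := by
          exact_mod_cast Finset.card_sdiff_add_card_inter _ _
        linarith [(hS _ hlt).1]
      · exact fun e he => (hS _ hlt).2 e (pairsIn_mono Finset.inter_subset_left he)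
    · have hle : t₀ ≤ (j + 1) * τ := ht₀.trans (Nat.mul_le_mul_right τ (by omega))
      classical
      have hex : ∃ n, a ≤ ((S (t₀ + n) \ U).card : ℝ) := by
        refine ⟨(j + 1) * τ - t₀, ?_⟩
        rw [Nat.add_sub_cancel' hle]
        exact not_lt.1 hstuck
      -- The first time with at least `a` vertices outside `U`. One step earlier there were fewer
      -- than `a`, and a step adds at most `δ`, whence the upper bound `h`.
      set n := Nat.find hex with hn
      have hn1 : a ≤ ((S (t₀ + n) \ U).card : ℝ) := Nat.find_spec hex
      have hn2 : n ≤ (j + 1) * τ - t₀ := by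
        refine Nat.find_min' hex ?_
        rw [Nat.add_sub_cancel' hle]
        exact not_lt.1 hstuck
      have hn0 : n ≠ 0 := by
        intro h0
        rw [h0, add_zero, Finset.sdiff_eq_empty_iff_subset.2 hU] at hn1
        simp only [Finset.card_empty, Nat.cast_zero] at hn1
        linarith
      obtain ⟨n', hn'⟩ := Nat.exists_eq_succ_of_ne_zero hn0
      have hprev : ((S (t₀ + n') \ U).card : ℝ) < a := by
        have := Nat.find_min hex (m := n') (by omega)
        exact not_le.1 this
      set t := t₀ + n with ht
      have htt : t = t₀ + n' + 1 := by omega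
      have htK : t < K + 1 := by omega
      have hup : ((S t \ U).card : ℝ) ≤ h := by
        have h1 : (S t \ U).card ≤ (S (t₀ + n') \ U).card + (S t \ S (t₀ + n')).card := by
          refine (Finset.card_le_card ?_).trans (Finset.card_union_le _ _)
          intro v hv
          simp only [Finset.mem_sdiff, Finset.mem_union] at hv ⊢
          tauto
        have h2 := hstep (t₀ + n') (by omega)
        rw [← htt] at h2
        have h3 : ((S t \ U).card : ℝ) ≤ (S (t₀ + n') \ U).card + (S t \ S (t₀ + n')).card := by
          exact_mod_cast h1
        linarith
      have hext : Extends a h s₀ U (S t) := ⟨hn1, hup, (hS t htK).1⟩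
      rcases ih (j + 1) t (by omega) (by omega) (U ∪ S t) Finset.subset_union_right
        (R ∪ pairsIn (S t)) (fun e => if e ∈ R then tm e else ⟨t, htK⟩) (by
          intro e he
          by_cases heR : e ∈ R
          · simpa only [heR, if_true] using hR e heR
          · simp only [heR, if_false]
            exact (hS t htK).2 e ((Finset.mem_union.1 he).resolve_left heR)) with hc | hc
      · exact Or.inl ⟨⟨t, htK⟩, S t, by simp only; omega, hext, hc⟩
      · obtain ⟨k, hk1, hk2, hc⟩ := hc
        refine Or.inr ⟨k, by omega, hk2, ?_⟩
        rw [show k - j = (k - (j + 1)) + 1 by omega]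
        refine ⟨⟨t, htK⟩, S t, ?_, hext, hc⟩
        have : (j + 1) * τ ≤ k * τ := Nat.mul_le_mul_right τ hk1
        simp only
        omega

end Dichotomy

/-! ### First moment bounds for the two outcomes. -/

section FirstMoment

variable {N K : ℕ}

lemma half_pow_eq_rpow (n : ℕ) : (1 / 2 : ℝ) ^ n = 2 ^ (-(n : ℝ)) := by
  rw [Real.rpow_neg zero_le_two, Real.rpow_natCast, one_div, inv_pow]

lemma sum_card_le_rpow {L E : ℝ} (hL : (N : ℝ) = 2 ^ L) (F : ℕ → ℝ)
    (hF : ∀ n, F n ≤ 2 ^ (E - L * n)) :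
    ∑ S : Finset (Fin N), F S.card ≤ (N + 1) * 2 ^ E := by
  have h := Finset.sum_powerset_apply_card F (x := (Finset.univ : Finset (Fin N)))
  rw [Finset.powerset_univ] at h
  rw [h]
  simp only [Finset.card_univ, Fintype.card_fin]
  calc _ ≤ ∑ n ∈ Finset.range (N + 1), (2 : ℝ) ^ E := by
        refine Finset.sum_le_sum fun n _ => ?_
        rw [nsmul_eq_mul]
        calc (N.choose n : ℝ) * F n ≤ (N : ℝ) ^ n * 2 ^ (E - L * n) := by
              refine (mul_le_mul_of_nonneg_left (hF n) (by positivity)).trans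
                (mul_le_mul_of_nonneg_right ?_ (by positivity))
              exact_mod_cast Nat.choose_le_pow N n
          _ = 2 ^ E := by
              rw [hL, ← Real.rpow_natCast, ← Real.rpow_mul zero_le_two,
                ← Real.rpow_add zero_lt_two]
              congr 1
              ring
    _ = _ := by simp

/-- Union bound over the at most `2 ^ B` subsets of `U`; the gap `τ` makes each pair of such a
subset cost `2 ^ (-θ)` even if it was prescribed absent before. -/
lemma pathProb_indepInside_le {ρ θ w : ℝ} (hρ0 : 0 ≤ ρ) (hρ1 : ρ ≤ 1) {τ T : ℕ} (hw : 1 ≤ w)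
    (hθ : 0 ≤ θ) (hτ : (1 + ρ ^ τ) / 2 ≤ 2 ^ (-θ)) (U : Finset (Fin N)) {B : ℝ}
    (hU : (U.card : ℝ) ≤ B) (R : Finset (Pair N)) (tm : Pair N → Fin (K + 1))
    (htm : ∀ e ∈ R, (tm e : ℕ) ≤ T) :
    pathProb (Pair N) ρ K
        (fun x => (∀ e ∈ R, x (tm e) e = false) ∧ IndepInside w (T + τ) U x)
      ≤ 2 ^ (B - θ * (w * (w - 1) / 2)) * (1 / 2) ^ R.card := by
  classical
  by_cases ht : T + τ < K + 1
  · calc _ ≤ pathProb (Pair N) ρ K (fun x => ∃ W ∈ U.powerset.filter fun W => w ≤ (W.card : ℝ),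
            (∀ e ∈ R, x (tm e) e = false) ∧ ∀ e ∈ pairsIn W, x ⟨T + τ, ht⟩ e = false) := by
          refine pathProb_mono hρ0 hρ1 ?_
          rintro x ⟨hR, _, W, hWU, hW, hx⟩
          exact ⟨W, by simp [hWU, hW], hR, hx⟩
      _ ≤ ∑ W ∈ U.powerset.filter fun W => w ≤ (W.card : ℝ),
            (1 / 2 : ℝ) ^ R.card * 2 ^ (-(θ * (w * (w - 1) / 2))) := by
          refine (pathProb_exists_le hρ0 hρ1 _ _).trans (Finset.sum_le_sum fun W hW => ?_)
          refine (pathProb_false_le hρ0 hρ1 R (pairsIn W) tm ⟨T + τ, ht⟩ τ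
            fun e he _ => Nat.add_le_add_right (htm e he) τ).trans ?_
          refine mul_le_mul_of_nonneg_left ?_ (by positivity)
          have hW := (Finset.mem_filter.1 hW).2
          calc ((1 + ρ ^ τ) / 2) ^ (pairsIn W).card ≤ (2 ^ (-θ)) ^ (pairsIn W).card := by
                exact pow_le_pow_left₀ (by positivity) hτ _
            _ = 2 ^ (-θ * (W.card * (W.card - 1) / 2)) := by
                rw [← Real.rpow_natCast, ← Real.rpow_mul zero_le_two, card_pairsIn,
                  Nat.cast_choose_two]
            _ ≤ _ := by
                refine Real.rpow_le_rpow_of_exponent_le one_le_two ?_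
                have : w * (w - 1) ≤ W.card * (W.card - 1) := by nlinarith
                nlinarith
      _ ≤ 2 ^ B * ((1 / 2 : ℝ) ^ R.card * 2 ^ (-(θ * (w * (w - 1) / 2)))) := by
          rw [Finset.sum_const, nsmul_eq_mul]
          refine mul_le_mul_of_nonneg_right ?_ (by positivity)
          calc _ ≤ ((U.powerset.card : ℕ) : ℝ) := by
                exact_mod_cast Finset.card_filter_le _ _
            _ = (2 : ℝ) ^ (U.card : ℝ) := by
                rw [Finset.card_powerset, Real.rpow_natCast]
                push_cast
                rfl
            _ ≤ _ := Real.rpow_le_rpow_of_exponent_le one_le_two hU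
      _ = _ := by
          rw [sub_eq_add_neg B, Real.rpow_add zero_lt_two]
          ring
  · calc _ ≤ pathProb (Pair N) ρ K (fun x => ∃ W ∈ (∅ : Finset ℕ), False) :=
          pathProb_mono hρ0 hρ1 fun x hx => absurd hx.2.1 ht
      _ ≤ 0 := (pathProb_exists_le hρ0 hρ1 _ _).trans (by simp)
      _ ≤ _ := by positivity

variable {ι L : ℝ}

lemma sum_extends_le_rpow (hι : 0 < ι) (hL0 : 0 < L) (hL : (N : ℝ) = 2 ^ L) {B : ℝ}
    (U : Finset (Fin N)) (R : Finset (Pair N)) (hU : (U.card : ℝ) ≤ B) (hR : R ⊆ pairsIn U)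
    (s : Finset (Finset (Fin N)))
    (hs : ∀ S ∈ s, Extends (ι / 4 * L) (ι / 2 * L) ((1 + ι) * L) U S) :
    ∑ S ∈ s, (1 / 2 : ℝ) ^ (pairsIn S \ R).card
      ≤ 2 ^ B * ((N + 1) * 2 ^ (-(ι ^ 2 / 8 * L ^ 2))) := by
  have hp : 0 < ι * L := mul_pos hι hL0
  -- At least `(1 + ι) * L - ι / 2 * L` old vertices must be avoided by each new one, which has `2 ^
  -- L` choices.
  refine (sum_extends_le (r := 2 ^ (-((1 + ι / 2) * L))) (q := 2 ^ (-(ι / 2 * L)))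
    (by positivity) (by positivity) ?_ ?_ ?_ U hR s hs).trans ?_
  · exact Real.rpow_le_one_of_one_le_of_nonpos one_le_two (by linarith)
  · rw [one_div, Real.inv_rpow zero_le_two, ← Real.rpow_neg zero_le_two]
    refine Real.rpow_le_rpow_of_exponent_le one_le_two ?_
    linarith
  · rw [hL, ← Real.rpow_add zero_lt_two]
    refine Real.rpow_le_rpow_of_exponent_le one_le_two ?_
    linarith
  · rw [← Real.rpow_mul zero_le_two, show -(ι / 2 * L) * (ι / 4 * L) = -(ι ^ 2 / 8 * L ^ 2) by ring,
      ← Real.rpow_natCast 2 U.card]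
    exact mul_le_mul_of_nonneg_right (Real.rpow_le_rpow_of_exponent_le one_le_two hU)
      (by positivity)

/-- The first moment bound for chains of extensions of a set `S`, with a terminal condition whose
conditional probability is controlled. -/
lemma pathProb_exists_chain_le {ρ : ℝ} (hρ0 : 0 ≤ ρ) (hρ1 : ρ ≤ 1) (hι : 0 < ι) (hL0 : 0 < L)
    (hL : (N : ℝ) = 2 ^ L) {T : ℕ} {term : Finset (Fin N) → (Fin (K + 1) → Input N) → Prop}
    (Γ : ℝ → ℝ) {E : ℝ} {k m : ℕ} (hkm : k ≤ m)
    (hbase : ∀ (B : ℝ) (U : Finset (Fin N)) (R : Finset (Pair N)) (tm : Pair N → Fin (K + 1)),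
      (U.card : ℝ) ≤ B → (∀ e ∈ R, (tm e : ℕ) ≤ T) →
      pathProb (Pair N) ρ K (fun x => (∀ e ∈ R, x (tm e) e = false) ∧ term U x)
        ≤ 2 ^ Γ B * (1 / 2) ^ R.card)
    (hK : (K + 1 : ℝ) ≤ 2 ^ L) (hN : (N + 1 : ℝ) ≤ 2 ^ (2 * L))
    (hE : ∀ n : ℝ, 0 ≤ n → k * (3 * L + (n + m * (ι / 2 * L)) - ι ^ 2 / 8 * L ^ 2) +
      Γ (n + m * (ι / 2 * L)) - n * (n - 1) / 2 + L * n ≤ E) :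
    pathProb (Pair N) ρ K (fun x => ∃ S : Finset (Fin N),
        Chain (ι / 4 * L) (ι / 2 * L) ((1 + ι) * L) T term x k S (pairsIn S) (fun _ => 0))
      ≤ 2 ^ (2 * L + E) := by
  have hp : 0 < ι * L := mul_pos hι hL0
  let F : ℕ → ℝ := fun n => ((K + 1) * (2 ^ ((n : ℝ) + m * (ι / 2 * L)) *
    ((N + 1) * 2 ^ (-(ι ^ 2 / 8 * L ^ 2))))) ^ k * 2 ^ Γ (n + m * (ι / 2 * L)) *
      (1 / 2) ^ n.choose 2
  calc _ ≤ ∑ S : Finset (Fin N), F S.card := by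
        refine (pathProb_mono (R := fun x => ∃ S ∈ (Finset.univ : Finset (Finset (Fin N))),
          Chain (ι / 4 * L) (ι / 2 * L) ((1 + ι) * L) T term x k S (pairsIn S) (fun _ => 0))
          hρ0 hρ1 fun x hx => by simpa using hx).trans ?_
        refine (pathProb_exists_le hρ0 hρ1 _ _).trans (Finset.sum_le_sum fun S _ => ?_)
        simp only [F]
        rw [← card_pairsIn S]
        refine pathProb_chain_le (B := S.card + m * (ι / 2 * L)) hρ0 hρ1 (by positivity)
          (by positivity) (by linarith) (fun U R tm hU htm => hbase _ U R tm hU htm)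
          (fun U R hU hR s hs => sum_extends_le_rpow hι hL0 hL U R hU hR s hs) k S _ _ ?_
          subset_rfl (by simp)
        have : (k : ℝ) ≤ m := by exact_mod_cast hkm
        have := mul_le_mul_of_nonneg_right this (show 0 ≤ ι / 2 * L by linarith)
        linarith
    _ ≤ (N + 1) * 2 ^ E := by
        refine sum_card_le_rpow hL F fun n => ?_
        calc F n ≤ (2 ^ L * (2 ^ ((n : ℝ) + m * (ι / 2 * L)) *
                (2 ^ (2 * L) * 2 ^ (-(ι ^ 2 / 8 * L ^ 2))))) ^ k * 2 ^ Γ (n + m * (ι / 2 * L)) *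
                (1 / 2) ^ n.choose 2 := by
              simp only [F]
              gcongr
          _ = 2 ^ (k * (3 * L + (n + m * (ι / 2 * L)) - ι ^ 2 / 8 * L ^ 2) +
                Γ (n + m * (ι / 2 * L)) - (n : ℝ) * (n - 1) / 2) := by
              rw [half_pow_eq_rpow, Nat.cast_choose_two, ← Real.rpow_add zero_lt_two,
                ← Real.rpow_add zero_lt_two, ← Real.rpow_add zero_lt_two, ← Real.rpow_natCast,
                ← Real.rpow_mul zero_le_two, ← Real.rpow_add zero_lt_two,
                ← Real.rpow_add zero_lt_two]
              congr 1
              ring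
          _ ≤ _ := by
              refine Real.rpow_le_rpow_of_exponent_le one_le_two ?_
              linarith [hE n n.cast_nonneg]
    _ ≤ 2 ^ (2 * L) * 2 ^ E := by gcongr
    _ = _ := (Real.rpow_add zero_lt_two _ _).symm

lemma pathProb_full_chain_le {ρ : ℝ} (hρ0 : 0 ≤ ρ) (hρ1 : ρ ≤ 1) (hι : 0 < ι) (hL0 : 0 < L)
    (hL : (N : ℝ) = 2 ^ L) {m : ℕ} (hm : 8 ≤ m * ι ^ 2) (hK : (K + 1 : ℝ) ≤ 2 ^ L)
    (hN : (N + 1 : ℝ) ≤ 2 ^ (2 * L)) :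
    pathProb (Pair N) ρ K (fun x => ∃ S : Finset (Fin N),
        Chain (ι / 4 * L) (ι / 2 * L) ((1 + ι) * L) K (fun _ _ => True) x m S (pairsIn S)
          (fun _ => 0))
      ≤ 2 ^ (2 * L + (m * (3 * L + m * (ι / 2 * L)) - L ^ 2 + (L + m + 1 / 2) ^ 2 / 2)) := by
  refine pathProb_exists_chain_le hρ0 hρ1 hι hL0 hL (fun _ => 0) le_rfl ?_ hK hN ?_
  · intro B U R tm _ _
    have := pathProb_false_le hρ0 hρ1 R ∅ tm (Fin.last K) 0 (by simp)
    simpa using this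
  · intro n _
    -- The gain of `m` extensions exceeds the `L ^ 2 / 2` of the initial set; completing the square
    -- maximizes over its size `n`.
    have h1 : L ^ 2 ≤ m * (ι ^ 2 / 8 * L ^ 2) := by nlinarith [sq_nonneg L]
    nlinarith [sq_nonneg (n - (L + m + 1 / 2))]

lemma pathProb_stuck_chain_le {ρ : ℝ} (hρ0 : 0 ≤ ρ) (hρ1 : ρ ≤ 1) (hι : 0 < ι) (hL1 : 1 ≤ L)
    (hL : (N : ℝ) = 2 ^ L) {k m τ : ℕ} (hkm : k ≤ m)
    (hτ : (1 + ρ ^ τ) / 2 ≤ 2 ^ (-((1 + ι) / (1 + 3 / 4 * ι) ^ 2)))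
    (hK : (K + 1 : ℝ) ≤ 2 ^ L) (hN : (N + 1 : ℝ) ≤ 2 ^ (2 * L)) :
    pathProb (Pair N) ρ K (fun x => ∃ S : Finset (Fin N),
        Chain (ι / 4 * L) (ι / 2 * L) ((1 + ι) * L) (k * τ)
          (IndepInside ((1 + ι) * L - ι / 4 * L) ((k + 1) * τ)) x k S (pairsIn S) (fun _ => 0))
      ≤ 2 ^ (2 * L + (m * (3 * L + m * (ι / 2 * L)) + m * (ι / 2 * L) - (1 + ι) * L ^ 2 / 2 +
        (1 + ι) * L / 2 + (L + m + 3 / 2) ^ 2 / 2)) := by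
  have hw : (1 + ι) * L - ι / 4 * L = (1 + 3 / 4 * ι) * L := by ring
  have hL0 : 0 < L := by linarith
  have hp : 0 < ι * L := mul_pos hι hL0
  rw [hw, Nat.add_mul, one_mul]
  set θ := (1 + ι) / (1 + 3 / 4 * ι) ^ 2 with hθ
  have hθ0 : 0 ≤ θ := by positivity
  have hθ2 : θ * (1 + 3 / 4 * ι) ^ 2 = 1 + ι := by
    rw [hθ]; field_simp
  have hθ1 : θ * (1 + 3 / 4 * ι) ≤ 1 + ι := by nlinarith
  refine pathProb_exists_chain_le hρ0 hρ1 hι hL0 hL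
    (fun B => B - θ * ((1 + 3 / 4 * ι) * L * ((1 + 3 / 4 * ι) * L - 1) / 2)) hkm ?_ hK hN ?_
  · intro B U R tm hU htm
    exact pathProb_indepInside_le hρ0 hρ1 (by nlinarith) hθ0 hτ U hU R tm htm
  · intro n hn
    have hkm' : (k : ℝ) ≤ m := by exact_mod_cast hkm
    -- As `k` may be 0, the gain of the extensions is discarded; the terminal condition alone beats
    -- the initial set.
    have h1 : k * (3 * L + (n + m * (ι / 2 * L)) - ι ^ 2 / 8 * L ^ 2)
        ≤ m * (3 * L + (n + m * (ι / 2 * L))) := by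
      refine (mul_le_mul_of_nonneg_left (sub_le_self _ (by positivity)) k.cast_nonneg).trans ?_
      exact mul_le_mul_of_nonneg_right hkm' (by positivity)
    have h2 : θ * ((1 + 3 / 4 * ι) * L * ((1 + 3 / 4 * ι) * L - 1) / 2)
        = (1 + ι) * L ^ 2 / 2 - θ * (1 + 3 / 4 * ι) * L / 2 := by
      rw [← hθ2]; ring
    have h3 := mul_le_mul_of_nonneg_right hθ1 hL0.le
    rw [h2]
    nlinarith [sq_nonneg (n - (L + m + 3 / 2))]

end FirstMoment

/-! ### Lower bound for stable successful paths. -/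

section StablePaths

variable {d : Type*} [Fintype d] [DecidableEq d] {κ : Type*} [Fintype κ]

lemma noise_stability_euclidean {D : ℕ} {A : (d → Bool) → EuclideanSpace ℝ κ}
    (hA : ∀ i, (fun y => A y i) ∈ degreeFunctions d Bool D) {ρ : ℝ} (h0 : 0 ≤ ρ) (h1 : ρ ≤ 1) :
    ∑ x, ∑ y, noiseKernel ρ x y * ‖A x - A y‖ ^ 2
      ≤ 2 * (D * (1 - ρ)) * ∑ x, ‖A x‖ ^ 2 := by
  have hD : 1 - ρ ^ D ≤ D * (1 - ρ) := by
    have := one_add_mul_le_pow (show (-2 : ℝ) ≤ ρ - 1 by linarith) D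
    rw [add_sub_cancel] at this
    linarith
  simp only [EuclideanSpace.real_norm_sq_eq, Finset.mul_sum, PiLp.sub_apply]
  calc _ = ∑ i, ∑ x, ∑ y, noiseKernel ρ x y * (A x i - A y i) ^ 2 := by
        exact (Finset.sum_congr rfl fun x _ => Finset.sum_comm).trans Finset.sum_comm
    _ ≤ ∑ i, 2 * (D * (1 - ρ)) * ∑ x, A x i ^ 2 := by
        refine Finset.sum_le_sum fun i _ => (noise_stability (hA i) h0 h1).trans ?_
        gcongr
    _ = _ := by
        simp only [Finset.mul_sum]
        rw [Finset.sum_comm]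

/-- The probability that all states of the noise chain lie in `G` and all its steps move `A` by
little is at least exponential in the length of the chain. -/
theorem pow_le_pathProb_stable {D : ℕ} {A : (d → Bool) → EuclideanSpace ℝ κ}
    (hA : ∀ i, (fun y => A y i) ∈ degreeFunctions d Bool D) {ρ : ℝ} (h0 : 0 ≤ ρ) (h1 : ρ ≤ 1)
    (G : Finset (d → Bool)) {v q : ℝ} (hv : 0 < v) (hq0 : 0 ≤ q)
    (hq : q ≤ ((G.card : ℝ) / 2 ^ Fintype.card d) ^ 2 -
      2 * (D * (1 - ρ)) * ((∑ x, ‖A x‖ ^ 2) / 2 ^ Fintype.card d) / v) (j : ℕ) :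
    q ^ 2 ^ j ≤ pathProb d ρ (2 ^ j) (fun x => (∀ t, x t ∈ G) ∧
      ∀ t : Fin (2 ^ j), ‖A (x t.castSucc) - A (x t.succ)‖ ^ 2 ≤ v) := by
  classical
  set n := Fintype.card d
  have hcard : (Fintype.card (d → Bool) : ℝ) = 2 ^ n := by simp [n]
  have hn : (0 : ℝ) < 2 ^ n := by positivity
  let Good : (d → Bool) → (d → Bool) → Prop := fun x y =>
    x ∈ G ∧ y ∈ G ∧ ‖A x - A y‖ ^ 2 ≤ v
  let M : (d → Bool) → (d → Bool) → ℝ := fun x y => if Good x y then noiseKernel ρ x y else 0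
  have hM0 : ∀ x y, 0 ≤ M x y := fun x y => by
    simp only [M]
    split_ifs
    exacts [noiseKernel_nonneg h0 h1 x y, le_rfl]
  have hMs : ∀ x y, M x y = M y x := fun x y => by
    simp only [M, Good, noiseKernel_comm ρ x y, norm_sub_rev (A x) (A y)]
    exact if_congr (by tauto) rfl rfl
  have hlow : q ≤ (∑ x, ∑ y, M x y) / Fintype.card (d → Bool) := by
    let g : (d → Bool) → ℝ := fun x => if x ∈ G then 1 else 0
    have hg : ∑ x, g x = G.card := by simp [g]
    have hpos := sq_sum_le_noise g h0
    rw [hg] at hpos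
    have hstab := noise_stability_euclidean hA h0 h1
    -- Markov's inequality, pointwise: a pair excluded for moving `A` too much has squared
    -- displacement over `v` at least 1.
    have hpt : ∀ x y, noiseKernel ρ x y * (g x * g y) - noiseKernel ρ x y * ‖A x - A y‖ ^ 2 / v
        ≤ M x y := by
      intro x y
      have hk := noiseKernel_nonneg h0 h1 x y
      have hd : 0 ≤ noiseKernel ρ x y * ‖A x - A y‖ ^ 2 / v := by positivity
      by_cases hx : x ∈ G
      · by_cases hy : y ∈ G
        · simp only [M, g, Good, hx, hy, if_true, true_and, mul_one]
          split_ifs with hs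
          · linarith
          · rw [mul_div_assoc]
            have : 1 ≤ ‖A x - A y‖ ^ 2 / v := (one_le_div hv).2 (not_le.1 hs).le
            nlinarith
        · simp only [g, hy, if_false, mul_zero, zero_sub]
          linarith [hM0 x y]
      · simp only [g, hx, if_false, zero_mul, mul_zero, zero_sub]
        linarith [hM0 x y]
    have hsum := Finset.sum_le_sum fun x (_ : x ∈ Finset.univ) =>
      Finset.sum_le_sum fun y (_ : y ∈ Finset.univ) => hpt x y
    simp only [Finset.sum_sub_distrib, ← Finset.sum_div] at hsum
    rw [hcard]
    refine hq.trans ?_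
    rw [le_div_iff₀ hn]
    refine le_trans ?_ hsum
    have e1 : ((G.card : ℝ) / 2 ^ n) ^ 2 * 2 ^ n
        ≤ ∑ x, ∑ y, noiseKernel ρ x y * (g x * g y) := by
      rw [div_pow, div_mul_eq_mul_div, div_le_iff₀ (by positivity)]
      nlinarith
    have e2 : (∑ x, ∑ y, noiseKernel ρ x y * ‖A x - A y‖ ^ 2) / v
        ≤ 2 * (D * (1 - ρ)) * ((∑ x, ‖A x‖ ^ 2) / 2 ^ n) / v * 2 ^ n := by
      rw [div_le_iff₀ hv]
      refine hstab.trans_eq ?_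
      field_simp
    rw [sub_mul]
    linarith
  refine (pow_le_pow_left₀ hq0 hlow _).trans ((pow_le_sum_pathWeight hM0 hMs j).trans ?_)
  rw [hcard]
  unfold pathProb
  refine div_le_div_of_nonneg_right (Finset.sum_le_sum fun x _ => ?_) hn.le
  by_cases hgood : ∀ t : Fin (2 ^ j), Good (x t.castSucc) (x t.succ)
  · rw [if_pos, mul_one]
    · refine Finset.prod_le_prod (fun t _ => hM0 _ _) fun t _ => ?_
      simp only [M, hgood t, if_true]
      exact le_rfl
    · refine ⟨fun t => ?_, fun t => (hgood t).2.2⟩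
      induction t using Fin.lastCases with
      | last =>
        have hpos : 2 ^ j - 1 < 2 ^ j := Nat.sub_lt (by positivity) one_pos
        have := (hgood ⟨2 ^ j - 1, hpos⟩).2.1
        have he : (⟨2 ^ j - 1, hpos⟩ : Fin (2 ^ j)).succ = Fin.last (2 ^ j) := by
          ext
          simp only [Fin.val_succ, Fin.val_last]
          omega
        rwa [he] at this
      | cast t => exact (hgood t).1
  · obtain ⟨t, ht⟩ := not_forall.1 hgood
    have : pathWeight M x = 0 :=
      Finset.prod_eq_zero (Finset.mem_univ t) (by simp only [M, ht, if_false])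
    rw [this]
    refine mul_nonneg (pathWeight_nonneg (fun a b => noiseKernel_nonneg h0 h1 a b) x) ?_
    split_ifs <;> norm_num

end StablePaths

/-! ### Stability of the rounded and repaired output. -/

section Rounding

variable {N : ℕ}

lemma quarter_le_sq_sub {a b : ℝ} (ha : roundEntry a = some false) (hb : roundEntry b = some true) :
    1 / 4 ≤ (a - b) ^ 2 := by
  have ha' : |a| ≤ 1 / 2 := by
    by_contra h
    simp only [roundEntry, h, if_false] at ha
    split_ifs at ha; simp at ha
  have hb' : 1 ≤ |b| := by
    by_contra h
    simp only [roundEntry, h, if_false] at hb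
    split_ifs at hb; simp at hb
  have h := abs_sub_abs_le_abs_sub b a
  rw [abs_sub_comm] at h
  rw [← sq_abs (a - b)]
  nlinarith

/-- A vertex entering the set is either repaired on one side or has its coordinate cross the gap
between 1/2 and 1 in absolute value, costing 1/4 in squared distance. -/
lemma card_sdiff_le (u v : EuclideanSpace ℝ (Fin N)) (S T : Finset (Fin N)) :
    ((T \ S).card : ℝ) ≤ hammingDist (indicatorVec S) (roundVec u) +
      hammingDist (indicatorVec T) (roundVec v) + 4 * ‖u - v‖ ^ 2 := by
  classical
  set Z : Finset (Fin N) := Finset.univ.filter fun i =>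
    roundVec u i = some false ∧ roundVec v i = some true with hZ
  have hsub : T \ S ⊆ (Finset.univ.filter fun i => indicatorVec S i ≠ roundVec u i) ∪
      (Finset.univ.filter fun i => indicatorVec T i ≠ roundVec v i) ∪ Z := by
    intro i hi
    rw [Finset.mem_sdiff] at hi
    by_cases h1 : indicatorVec S i = roundVec u i
    · by_cases h2 : indicatorVec T i = roundVec v i
      · refine Finset.mem_union_right _ (Finset.mem_filter.2 ⟨Finset.mem_univ _, ?_, ?_⟩)
        · rw [← h1]; simp [indicatorVec, hi.2]
        · rw [← h2]; simp [indicatorVec, hi.1]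
      · exact Finset.mem_union_left _ (Finset.mem_union_right _ (by simpa using h2))
    · exact Finset.mem_union_left _ (Finset.mem_union_left _ (by simpa using h1))
  have hcard := (Finset.card_le_card hsub).trans ((Finset.card_union_le _ _).trans
    (Nat.add_le_add_right (Finset.card_union_le _ _) _))
  have hZc : (Z.card : ℝ) ≤ 4 * ‖u - v‖ ^ 2 := by
    have h1 : ∑ i ∈ Z, (1 / 4 : ℝ) ≤ ∑ i ∈ Z, (u i - v i) ^ 2 :=
      Finset.sum_le_sum fun i hi => by
        have := (Finset.mem_filter.1 hi).2
        exact quarter_le_sq_sub this.1 this.2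
    have h2 : ∑ i ∈ Z, (u i - v i) ^ 2 ≤ ∑ i, (u i - v i) ^ 2 :=
      Finset.sum_le_sum_of_subset_of_nonneg (Finset.subset_univ _) fun _ _ _ => sq_nonneg _
    rw [EuclideanSpace.real_norm_sq_eq]
    simp only [PiLp.sub_apply]
    rw [Finset.sum_const, nsmul_eq_mul] at h1
    linarith
  have hcard' : ((T \ S).card : ℝ) ≤ hammingDist (indicatorVec S) (roundVec u) +
      hammingDist (indicatorVec T) (roundVec v) + Z.card := by
    exact_mod_cast hcard
  linarith

end Rounding

/-! ### Lower and upper bounds combined at fixed `N`. -/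

section FixedSize

variable {N : ℕ} {ι L : ℝ}

/-- The quantitative form of the hardness result at a fixed number of vertices: `G` is the set of
inputs on which a deterministic low degree algorithm succeeds. -/
theorem pow_le_of_success {D : ℕ} {A : Input N → EuclideanSpace ℝ (Fin N)}
    (hA : ∀ i, (fun y => A y i) ∈ degreeFunctions (Pair N) Bool D)
    {F : (Fin N → Option Bool) → Input N → Option (Finset (Fin N))}
    (hι : 0 < ι) (hF : IsRepairing (ι / 12) F) (hL1 : 1 ≤ L) (hL : (N : ℝ) = 2 ^ L)
    (hN : (N + 1 : ℝ) ≤ 2 ^ (2 * L)) {ρ : ℝ} (h0 : 0 ≤ ρ) (h1 : ρ ≤ 1) {m τ j : ℕ}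
    (hm : 8 ≤ m * ι ^ 2) (hτ : (1 + ρ ^ τ) / 2 ≤ 2 ^ (-((1 + ι) / (1 + 3 / 4 * ι) ^ 2)))
    (hj : m * τ ≤ 2 ^ j) (hK : (2 ^ j + 1 : ℝ) ≤ 2 ^ L) (G : Finset (Input N))
    (hG : ∀ y ∈ G, IsLargeIndepSet ι y (F (roundVec (A y)) y)) {q : ℝ} (hq0 : 0 ≤ q)
    (hq : q ≤ ((G.card : ℝ) / 2 ^ Fintype.card (Pair N)) ^ 2 -
      2 * (D * (1 - ρ)) * ((∑ x, ‖A x‖ ^ 2) / 2 ^ Fintype.card (Pair N)) / (ι / 48 * L)) :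
    q ^ 2 ^ j ≤
      2 ^ (2 * L + (m * (3 * L + m * (ι / 2 * L)) - L ^ 2 + (L + m + 1 / 2) ^ 2 / 2)) +
      m * 2 ^ (2 * L + (m * (3 * L + m * (ι / 2 * L)) + m * (ι / 2 * L) - (1 + ι) * L ^ 2 / 2 +
        (1 + ι) * L / 2 + (L + m + 3 / 2) ^ 2 / 2)) := by
  classical
  have hL0 : 0 < L := by linarith
  have hlog : Real.logb 2 N = L := by rw [hL, Real.logb_rpow zero_lt_two (by norm_num)]
  have hp : 0 < ι * L := mul_pos hι hL0
  have hK' : ((2 ^ j : ℕ) + 1 : ℝ) ≤ 2 ^ L := by exact_mod_cast hK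
  let Stuck : ℕ → (Fin (2 ^ j + 1) → Input N) → Prop := fun k x => ∃ S : Finset (Fin N),
    Chain (ι / 4 * L) (ι / 2 * L) ((1 + ι) * L) (k * τ)
      (IndepInside ((1 + ι) * L - ι / 4 * L) ((k + 1) * τ)) x k S (pairsIn S) (fun _ => 0)
  refine (pow_le_pathProb_stable hA h0 h1 G (v := ι / 48 * L) (by linarith) hq0 hq j).trans ?_
  calc _ ≤ pathProb (Pair N) ρ (2 ^ j) (fun x => (∃ S : Finset (Fin N),
        Chain (ι / 4 * L) (ι / 2 * L) ((1 + ι) * L) (2 ^ j) (fun _ _ => True) x m S (pairsIn S)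
          (fun _ => 0)) ∨ ∃ k ∈ Finset.range m, Stuck k x) := by
        refine pathProb_mono h0 h1 ?_
        rintro x ⟨hxG, hxv⟩
        choose S hS1 hS2 hS3 using fun t => hG (x t) (hxG t)
        let S' : ℕ → Finset (Fin N) := fun t => if ht : t < 2 ^ j + 1 then S ⟨t, ht⟩ else ∅
        have hS' : ∀ t (ht : t < 2 ^ j + 1), S' t = S ⟨t, ht⟩ := fun t ht => dif_pos ht
        -- The step size is two repairs of `ι / 12 * L` plus `4 * (ι / 48 * L)` from the
        -- displacement of `A`, which is `ι / 4 * L`.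
        have hdich := chain_or_indepInside (a := ι / 4 * L) (δ := ι / 4 * L) (h := ι / 2 * L)
          (s₀ := (1 + ι) * L) (by linarith) (by linarith) hj x S' (fun t ht => by
            rw [hS' t ht]
            refine ⟨?_, fun e he => eq_false_of_isIndepSet (hS2 _) he⟩
            have := hS3 ⟨t, ht⟩
            rwa [hlog] at this) (fun t ht => by
            rw [hS' t (by omega), hS' (t + 1) (by omega)]
            have hle := card_sdiff_le (A (x ⟨t, by omega⟩)) (A (x ⟨t + 1, by omega⟩))
              (S ⟨t, by omega⟩) (S ⟨t + 1, by omega⟩)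
            have hd1 := (hF _ _ _ (hS1 ⟨t, by omega⟩)).2
            have hd2 := (hF _ _ _ (hS1 ⟨t + 1, by omega⟩)).2
            rw [hlog] at hd1 hd2
            have hv := hxv ⟨t, ht⟩
            simp only [Fin.castSucc_mk, Fin.succ_mk] at hv
            linarith) m 0 0 (by omega) (by simp) (S' 0) subset_rfl (pairsIn (S' 0)) (fun _ => 0)
            (fun e he => by
              rw [hS' 0 (by omega)] at he
              exact eq_false_of_isIndepSet (hS2 _) he)
        rcases hdich with hc | ⟨k, -, hk, hc⟩
        · exact Or.inl ⟨_, hc⟩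
        · exact Or.inr ⟨k, Finset.mem_range.2 hk, _, hc⟩
    _ ≤ _ := by
        refine (pathProb_or_le h0 h1 _ _).trans (add_le_add ?_ ?_)
        · exact pathProb_full_chain_le h0 h1 hι hL0 hL hm hK' hN
        · refine (pathProb_exists_le h0 h1 _ _).trans ?_
          refine (Finset.sum_le_sum fun k hk => pathProb_stuck_chain_le h0 h1 hι hL1 hL
            (Finset.mem_range.1 hk).le hτ hK' hN).trans_eq ?_
          rw [Finset.sum_const, Finset.card_range, nsmul_eq_mul]

end FixedSize

/-! ### Choice of parameters and asymptotics. -/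

section Asymptotic

lemma eventually_linear_le_quadratic {α : ℝ} (hα : 0 < α) (a b : ℝ) :
    ∀ᶠ L : ℝ in atTop, a * L + b ≤ α * L ^ 2 := by
  filter_upwards [eventually_ge_atTop 1, eventually_ge_atTop ((|a| + |b|) / α)] with L h1 h2
  rw [div_le_iff₀ hα] at h2
  have ha := le_abs_self a
  have hb := le_abs_self b
  have hb0 := abs_nonneg b
  calc a * L + b ≤ |a| * L + |b| * L := by nlinarith
    _ = (|a| + |b|) * L := by ring
    _ ≤ L * α * L := by gcongr
    _ = _ := by ring

lemma tendsto_logb_natCast : Tendsto (fun N : ℕ => Real.logb 2 N) atTop atTop :=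
  (Real.tendsto_logb_atTop one_lt_two).comp tendsto_natCast_atTop_atTop

lemma log_eq_logb_mul (x : ℝ) : Real.log x = Real.logb 2 x * Real.log 2 := by
  rw [Real.logb, div_mul_cancel₀]
  exact (Real.log_pos one_lt_two).ne'

lemma log_natCast_le_logb {N : ℕ} (hL : 0 ≤ Real.logb 2 N) : Real.log N ≤ Real.logb 2 N := by
  rw [log_eq_logb_mul]
  have := Real.log_two_lt_d9
  nlinarith

variable {ι : ℝ} {D : ℕ → ℕ}

lemma eventually_degree_le (hD : (fun N : ℕ => (D N : ℝ)) =o[atTop] (fun N : ℕ => Real.log N ^ 2))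
    {c r : ℝ} (hc : 0 < c) (hr : 0 < r) :
    ∀ᶠ N : ℕ in atTop, r * (D N + 1) ≤ c * Real.logb 2 N ^ 2 := by
  filter_upwards [hD.bound (c := c / (2 * r)) (by positivity), tendsto_logb_natCast.eventually
    (eventually_linear_le_quadratic (half_pos hc) 0 r),
    tendsto_logb_natCast.eventually (eventually_ge_atTop 0)] with N h1 h2 h3
  have h4 : ‖(D N : ℝ)‖ = D N := by simp
  have h5 : ‖Real.log (N : ℝ) ^ 2‖ = Real.log N ^ 2 := by simp
  rw [h4, h5] at h1
  have h6 : Real.log (N : ℝ) ^ 2 ≤ Real.logb 2 N ^ 2 :=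
    pow_le_pow_left₀ (Real.log_natCast_nonneg N) (log_natCast_le_logb h3) 2
  have h7 : r * D N ≤ c / 2 * Real.logb 2 N ^ 2 := by
    calc r * D N ≤ r * (c / (2 * r) * Real.logb 2 N ^ 2) := by
          refine mul_le_mul_of_nonneg_left (h1.trans ?_) hr.le
          exact mul_le_mul_of_nonneg_left h6 (by positivity)
      _ = _ := by field_simp
  linarith

lemma eventually_steps_le (hD : (fun N : ℕ => (D N : ℝ)) =o[atTop] (fun N : ℕ => Real.log N ^ 2))
    {r : ℝ} (hr : 0 < r) :
    ∀ᶠ N : ℕ in atTop, r * (D N + 1) + 1 ≤ N := by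
  have ho := ((Real.isLittleO_pow_log_id_atTop (n := 2)).comp_tendsto tendsto_natCast_atTop_atTop)
  filter_upwards [(hD.trans ho).bound (c := 1 / (2 * r)) (by positivity),
    tendsto_natCast_atTop_atTop.eventually (eventually_ge_atTop (2 * (r + 1)))] with N h1 h2
  have h4 : ‖(D N : ℝ)‖ = D N := by simp
  have h5 : ‖(id ∘ fun n : ℕ => (n : ℝ)) N‖ = N := by simp
  rw [h4, h5] at h1
  have h7 : r * D N ≤ N / 2 := by
    calc r * D N ≤ r * (1 / (2 * r) * N) := mul_le_mul_of_nonneg_left h1 hr.le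
      _ = _ := by field_simp
  linarith

/-- The first moment bounds are eventually smaller than any lower bound that is exponential in the
degree. -/
lemma eventually_first_moment_lt (hι : 0 < ι)
    (hD : (fun N : ℕ => (D N : ℝ)) =o[atTop] (fun N : ℕ => Real.log N ^ 2)) (m : ℕ) {q r : ℝ}
    (hq0 : 0 < q) (hq1 : q < 1) (hr : 0 < r) :
    ∀ᶠ N : ℕ in atTop, ∀ K : ℕ, (K : ℝ) ≤ r * (D N + 1) → ∀ L : ℝ, L = Real.logb 2 N →
      (2 : ℝ) ^ (2 * L + (m * (3 * L + m * (ι / 2 * L)) - L ^ 2 + (L + m + 1 / 2) ^ 2 / 2)) +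
      m * 2 ^ (2 * L + (m * (3 * L + m * (ι / 2 * L)) + m * (ι / 2 * L) - (1 + ι) * L ^ 2 / 2 +
        (1 + ι) * L / 2 + (L + m + 3 / 2) ^ 2 / 2)) < q ^ K := by
  set c : ℝ := min 1 ι / 4 with hc
  have hc0 : 0 < c := by positivity
  have hc1 : c ≤ 1 / 4 := by rw [hc]; linarith [min_le_left 1 ι]
  have hcι : c ≤ ι / 4 := by rw [hc]; linarith [min_le_right 1 ι]
  set Q : ℝ := -Real.logb 2 q with hQ
  have hQ0 : 0 < Q := neg_pos.2 (Real.logb_neg one_lt_two hq0 hq1)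
  have hqQ : q = 2 ^ (-Q) := by
    rw [hQ, neg_neg, Real.rpow_logb zero_lt_two (by norm_num) hq0]
  filter_upwards [eventually_degree_le hD hc0 (mul_pos hQ0 hr),
    tendsto_logb_natCast.eventually (eventually_linear_le_quadratic (α := 1 / 4) (by norm_num)
      (2 + 3 * m + m ^ 2 * ι / 2 + m + 1 / 2) ((m + 1 / 2) ^ 2 / 2 + (m + 1))),
    tendsto_logb_natCast.eventually (eventually_linear_le_quadratic (α := ι / 4) (by positivity)
      (2 + 3 * m + m ^ 2 * ι / 2 + m * ι / 2 + (1 + ι) / 2 + m + 3 / 2)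
      ((m + 3 / 2) ^ 2 / 2 + (m + 1)))] with N h1 h2 h3 K hK L hL
  rw [← hL] at h1 h2 h3
  set x := c * L ^ 2 with hx
  have hcL1 : x ≤ 1 / 4 * L ^ 2 := mul_le_mul_of_nonneg_right hc1 (sq_nonneg L)
  have hcLι : x ≤ ι / 4 * L ^ 2 := mul_le_mul_of_nonneg_right hcι (sq_nonneg L)
  have hlow : (2 : ℝ) ^ (-x) ≤ q ^ K := by
    rw [hqQ, ← Real.rpow_natCast, ← Real.rpow_mul zero_le_two]
    refine Real.rpow_le_rpow_of_exponent_le one_le_two ?_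
    have := mul_le_mul_of_nonneg_left hK hQ0.le
    nlinarith
  -- The slack `m + 1` reserved in the exponents absorbs the `m + 1` summands.
  have hm : ((m : ℝ) + 1) * 2 ^ (-((m : ℝ) + 1)) < 1 := by
    have h : ((m + 1 : ℕ) : ℝ) < 2 ^ (m + 1) := by exact_mod_cast Nat.lt_two_pow_self
    rw [Real.rpow_neg zero_le_two, ← div_eq_mul_inv, div_lt_one (by positivity)]
    calc (m : ℝ) + 1 = ((m + 1 : ℕ) : ℝ) := by push_cast; rfl
      _ < 2 ^ (m + 1) := h
      _ = _ := by rw [← Real.rpow_natCast]; push_cast; rfl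
  refine lt_of_lt_of_le ?_ hlow
  calc _ ≤ (2 : ℝ) ^ (-((m : ℝ) + 1) + -x) + m * 2 ^ (-((m : ℝ) + 1) + -x) := by
        refine add_le_add (Real.rpow_le_rpow_of_exponent_le one_le_two ?_)
          (mul_le_mul_of_nonneg_left (Real.rpow_le_rpow_of_exponent_le one_le_two ?_)
            m.cast_nonneg)
        · linarith
        · linarith
    _ = ((m : ℝ) + 1) * 2 ^ (-((m : ℝ) + 1)) * 2 ^ (-x) := by
        rw [Real.rpow_add zero_lt_two]; ring
    _ < _ := by
        have : (0 : ℝ) < 2 ^ (-x) := by positivity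
        nlinarith

/-- Existence of a mixing time and of a power of two length that are linear in the degree. -/
lemma exists_steps {κ c₁ : ℝ} (hκ : 0 < κ) (hc : 0 < c₁) (hc1 : c₁ ≤ 1) {m : ℕ} (hm : 0 < m) :
    ∃ r : ℝ, 0 < r ∧ ∀ D : ℕ, ∃ τ j : ℕ, (1 - c₁ / (D + 1)) ^ τ ≤ κ ∧ m * τ ≤ 2 ^ j ∧
      (2 ^ j : ℝ) ≤ r * (D + 1) := by
  refine ⟨2 * m * (|Real.log κ| / c₁ + 2), by positivity, fun D => ?_⟩
  set ε := c₁ / (D + 1 : ℝ) with hε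
  have hε0 : 0 < ε := by positivity
  have hε1 : ε ≤ 1 := by
    rw [hε, div_le_one (by positivity)]
    linarith [(D.cast_nonneg : (0 : ℝ) ≤ D)]
  -- The extra 1 keeps `τ` nonzero, as needed to locate `m * τ` between powers of two.
  set τ := ⌈|Real.log κ| / ε⌉₊ + 1 with hτ
  have hτ1 : |Real.log κ| ≤ ε * τ := by
    have h := Nat.le_ceil (|Real.log κ| / ε)
    rw [div_le_iff₀ hε0] at h
    rw [hτ]
    push_cast
    nlinarith
  have hτ2 : (τ : ℝ) ≤ (|Real.log κ| / c₁ + 2) * (D + 1) := by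
    have h := (Nat.ceil_lt_add_one (show 0 ≤ |Real.log κ| / ε by positivity)).le
    have he : |Real.log κ| / ε = |Real.log κ| / c₁ * (D + 1) := by
      rw [hε]; field_simp
    rw [hτ]
    push_cast
    rw [he] at h ⊢
    nlinarith [(D.cast_nonneg : (0 : ℝ) ≤ D)]
  obtain ⟨n, hn1, hn2⟩ := exists_nat_pow_near (x := m * τ) (y := 2)
    (Nat.one_le_iff_ne_zero.2 (Nat.mul_ne_zero hm.ne' (by omega))) one_lt_two
  refine ⟨τ, n + 1, ?_, hn2.le, ?_⟩
  · calc (1 - ε) ^ τ ≤ Real.exp (-ε) ^ τ :=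
          pow_le_pow_left₀ (by linarith) (Real.one_sub_le_exp_neg ε) _
      _ = Real.exp (-(ε * τ)) := by rw [← Real.exp_nat_mul]; ring_nf
      _ ≤ Real.exp (Real.log κ) := Real.exp_le_exp.2 (by linarith [neg_abs_le (Real.log κ)])
      _ = κ := Real.exp_log hκ
  · have h : ((2 ^ n : ℕ) : ℝ) ≤ ((m * τ : ℕ) : ℝ) := by exact_mod_cast hn1
    push_cast at h
    rw [pow_succ]
    have := mul_le_mul_of_nonneg_left hτ2 (show (0 : ℝ) ≤ 2 * m by positivity)
    nlinarith

/-- Low degree hardness for deterministic algorithms: the success probability is eventually below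
any given positive constant. -/
theorem eventually_success_lt (hι : 0 < ι)
    (hD : (fun N : ℕ => (D N : ℝ)) =o[atTop] (fun N : ℕ => Real.log N ^ 2)) {p C : ℝ}
    (hp0 : 0 < p) (hp1 : p ≤ 1) (hC : 0 < C) :
    ∀ᶠ N : ℕ in atTop, ∀ (A : Input N → EuclideanSpace ℝ (Fin N))
      (F : (Fin N → Option Bool) → Input N → Option (Finset (Fin N))) (G : Finset (Input N)),
      (∀ i, (fun y => A y i) ∈ degreeFunctions (Pair N) Bool (D N)) →
      IsRepairing (ι / 12) F →
      (∀ y ∈ G, IsLargeIndepSet ι y (F (roundVec (A y)) y)) →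
      (∑ y, ‖A y‖ ^ 2) / 2 ^ Fintype.card (Pair N) ≤ C * Real.log N →
      (G.card : ℝ) / 2 ^ Fintype.card (Pair N) < p := by
  obtain ⟨m, hm⟩ := exists_nat_gt (8 / ι ^ 2)
  have hm8 : 8 ≤ m * ι ^ 2 := ((div_lt_iff₀ (by positivity)).1 hm).le
  have hm0 : 0 < m := by
    have : (0 : ℝ) < m := lt_trans (by positivity) hm
    exact_mod_cast this
  -- Chosen so that a stuck set of size `(1 + 3 / 4 * ι) * L` costs about `(1 + ι) * L ^ 2 / 2` in
  -- the exponent; `θ < 1` leaves room for a finite mixing time.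
  set θ := (1 + ι) / (1 + 3 / 4 * ι) ^ 2 with hθ
  have hθ1 : θ < 1 := by
    rw [hθ, div_lt_one (by positivity)]
    nlinarith
  have hκ : 0 < 2 * (2 : ℝ) ^ (-θ) - 1 := by
    have h : (2 : ℝ) ^ (-1 : ℝ) < 2 ^ (-θ) :=
      Real.rpow_lt_rpow_of_exponent_lt one_lt_two (by linarith)
    rw [Real.rpow_neg_one] at h
    linarith
  -- Makes the instability term `2 * c₁ * (C * L) / (ι / 48 * L)` at most `p ^ 2 / 2`, half of the
  -- mass of pairs in `G`.
  set c₁ : ℝ := min 1 (ι * p ^ 2 / (192 * C)) with hc₁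
  have hc0 : 0 < c₁ := by positivity
  have hc1 : c₁ ≤ 1 := min_le_left _ _
  have hc2 : 192 * C * c₁ ≤ ι * p ^ 2 := by
    have h := min_le_right 1 (ι * p ^ 2 / (192 * C))
    rw [← hc₁, le_div_iff₀ (by positivity)] at h
    linarith
  obtain ⟨r, hr, hsteps⟩ := exists_steps hκ hc0 hc1 hm0
  have hq1 : p ^ 2 / 2 < 1 := by nlinarith
  filter_upwards [eventually_first_moment_lt hι hD m (by positivity) hq1 hr,
    eventually_steps_le hD hr, tendsto_logb_natCast.eventually (eventually_ge_atTop 1),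
    eventually_ge_atTop 2] with N hfm hst hL1 hN2 A F G hA hF hG hnorm
  by_contra! hpG
  set L := Real.logb 2 N with hLdef
  have hN0 : (0 : ℝ) < N := by
    have : 0 < N := by omega
    exact_mod_cast this
  have hL : (N : ℝ) = 2 ^ L := (Real.rpow_logb zero_lt_two (by norm_num) hN0).symm
  have hNL : (N + 1 : ℝ) ≤ 2 ^ (2 * L) := by
    rw [mul_comm, Real.rpow_mul zero_le_two, ← hL]
    norm_num
    have : (2 : ℝ) ≤ N := by exact_mod_cast hN2
    nlinarith
  obtain ⟨τ, j, hτ, hj, hjr⟩ := hsteps (D N)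
  have hε0 : 0 < c₁ / (D N + 1 : ℝ) := by positivity
  have hε1 : c₁ / (D N + 1 : ℝ) ≤ 1 := by
    rw [div_le_one (by positivity)]
    linarith [((D N).cast_nonneg : (0 : ℝ) ≤ D N)]
  refine absurd (hfm (2 ^ j) (by exact_mod_cast hjr) L rfl) (not_lt.2 ?_)
  refine pow_le_of_success hA hι hF hL1 hL hNL (ρ := 1 - c₁ / (D N + 1)) (by linarith)
    (by linarith) hm8 (τ := τ) (by linarith) hj (by rw [← hL]; linarith) G hG (by positivity) ?_
  have hlogL : Real.log N ≤ L := log_natCast_le_logb (by linarith)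
  have h1 : D N * (1 - (1 - c₁ / (D N + 1 : ℝ))) ≤ c₁ := by
    rw [sub_sub_cancel, ← mul_div_assoc, div_le_iff₀ (by positivity)]
    nlinarith
  have h2 : 2 * (D N * (1 - (1 - c₁ / (D N + 1 : ℝ)))) *
      ((∑ x, ‖A x‖ ^ 2) / 2 ^ Fintype.card (Pair N)) / (ι / 48 * L) ≤ p ^ 2 / 2 := by
    rw [div_le_iff₀ (by positivity)]
    calc _ ≤ 2 * c₁ * (C * L) := by
          gcongr
          exact hnorm.trans (by gcongr)
      _ ≤ _ := by nlinarith
  have h3 : p ^ 2 ≤ ((G.card : ℝ) / 2 ^ Fintype.card (Pair N)) ^ 2 :=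
    pow_le_pow_left₀ hp0.le hpG 2
  linarith

end Asymptotic

/-! ### Measurability and fixing the internal randomness. -/

section Randomness

variable {N : ℕ}

instance (N : ℕ) : IsProbabilityMeasure (gnpHalf N) := by
  unfold gnpHalf
  infer_instance

lemma gnpHalf_real_singleton (y : Input N) :
    (gnpHalf N).real {y} = (1 / 2) ^ Fintype.card (Pair N) := by
  have h : ∀ b : Bool, (bernoulliMeasure true false half).real {b} = 1 / 2 := by
    intro b
    rw [bernoulliMeasure_real_apply half (measurableSet_singleton b)]
    cases b <;> norm_num [half]
  simp only [Measure.real] at h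
  simp only [gnpHalf, Measure.real, Measure.pi_singleton, ENNReal.toReal_prod, h,
    Finset.prod_const, Finset.card_univ]

lemma integral_gnpHalf (f : Input N → ℝ) :
    ∫ y, f y ∂gnpHalf N = (∑ y, f y) / 2 ^ Fintype.card (Pair N) := by
  rw [integral_fintype .of_finite, Finset.sum_div]
  refine Finset.sum_congr rfl fun y _ => ?_
  rw [gnpHalf_real_singleton, smul_eq_mul, one_div, inv_pow, div_eq_inv_mul]

lemma measurableSet_isLargeIndepSet {Ω : Type*} [MeasurableSpace Ω] (ι : ℝ)
    {A : Input N → Ω → EuclideanSpace ℝ (Fin N)}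
    (hA : Measurable fun p : Input N × Ω => A p.1 p.2)
    (F : (Fin N → Option Bool) → Input N → Option (Finset (Fin N))) :
    MeasurableSet {p : Input N × Ω | IsLargeIndepSet ι p.1 (output A F p.1 p.2)} := by
  let : MeasurableSpace (Option Bool) := ⊤
  have hround : Measurable roundEntry := by
    refine Measurable.ite (measurableSet_le measurable_norm measurable_const) measurable_const ?_
    exact Measurable.ite (measurableSet_le measurable_const measurable_norm) measurable_const
      measurable_const
  have hvec : Measurable fun p : Input N × Ω => roundVec (A p.1 p.2) := by
    refine measurable_pi_iff.2 fun i => hround.comp ?_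
    exact ((EuclideanSpace.proj i : EuclideanSpace ℝ (Fin N) →L[ℝ] ℝ).continuous.measurable).comp hA
  have hpair : Measurable fun p : Input N × Ω => (p.1, roundVec (A p.1 p.2)) :=
    measurable_fst.prodMk hvec
  exact hpair (Set.toFinite
    {z : Input N × (Fin N → Option Bool) | IsLargeIndepSet ι z.1 (F z.2 z.1)}).measurableSet

/-- A randomized algorithm of success probability at least `δ` and of small second moment has a
realization of its randomness with both properties. -/
lemma exists_good_realization {Ω : Type*} [MeasurableSpace Ω] {P : Measure Ω}
    [IsProbabilityMeasure P] {g : Input N × Ω → ℝ} {s : Set (Input N × Ω)} (hs : MeasurableSet s)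
    (hg0 : ∀ p, 0 ≤ g p) (hg : Integrable g ((gnpHalf N).prod P)) {δ c : ℝ} (hδ : 0 < δ)
    (hc : 0 < c) (hgc : ∫ p, g p ∂(gnpHalf N).prod P ≤ δ / 4 * c)
    (hsδ : δ ≤ ((gnpHalf N).prod P).real s) :
    ∃ ω, (∑ y, g (y, ω)) / 2 ^ Fintype.card (Pair N) ≤ c ∧ ∀ G : Finset (Input N),
      (∀ y, y ∈ G ↔ (y, ω) ∈ s) → δ / 2 ≤ (G.card : ℝ) / 2 ^ Fintype.card (Pair N) := by
  classical
  have hind : Integrable (s.indicator (1 : Input N × Ω → ℝ)) ((gnpHalf N).prod P) :=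
    (integrable_const (1 : ℝ)).indicator hs
  have hint : Integrable (fun p => s.indicator 1 p - g p / c) ((gnpHalf N).prod P) :=
    hind.sub (hg.div_const c)
  -- One combined functional secures both properties: at an ω reaching its mean, success is at least
  -- `3 / 4 * δ`, and since success is at most 1 the mean of `g` is at most `c`.
  have hval : 3 / 4 * δ ≤ ∫ p, (s.indicator 1 p - g p / c) ∂(gnpHalf N).prod P := by
    rw [integral_sub hind (hg.div_const c),
      integral_indicator_one hs, integral_div]
    have : (∫ p, g p ∂(gnpHalf N).prod P) / c ≤ δ / 4 := (div_le_iff₀ hc).2 hgc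
    linarith
  obtain ⟨ω, hω⟩ := exists_integral_le hint.integral_prod_right
  rw [integral_prod_symm _ hint] at hval
  have hle := hval.trans hω
  rw [integral_gnpHalf, Finset.sum_sub_distrib, sub_div, ← Finset.sum_div, div_right_comm] at hle
  set n := Fintype.card (Pair N)
  have hn : (0 : ℝ) < 2 ^ n := by positivity
  set G₀ : Finset (Input N) := Finset.univ.filter fun y => (y, ω) ∈ s with hG₀
  have hcount : ∑ y, s.indicator (1 : Input N × Ω → ℝ) (y, ω) = (G₀.card : ℝ) := by
    simp [Set.indicator_apply, hG₀]
  rw [hcount] at hle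
  have h1 : (G₀.card : ℝ) / 2 ^ n ≤ 1 := by
    rw [div_le_one hn]
    have h := Finset.card_le_univ G₀
    rw [Fintype.card_fun, Fintype.card_bool] at h
    exact_mod_cast h
  have h0 : 0 ≤ (∑ y, g (y, ω)) / 2 ^ n / c :=
    div_nonneg (div_nonneg (Finset.sum_nonneg fun y _ => hg0 _) hn.le) hc.le
  refine ⟨ω, ?_, fun G hG => ?_⟩
  · rw [← div_le_one hc]
    linarith
  · have : G = G₀ := by
      ext y
      simp [hG₀, hG]
    rw [this]
    linarith

end Randomness

end DenseIndSet

/-! ### The corollary. -/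

theorem corollary3p19 (ι : ℝ) (hι : 0 < ι) :
    ∃ b : ℝ, 0 < b ∧
      ∀ (C : ℝ) (D : ℕ → ℕ),
        (fun N : ℕ => (D N : ℝ)) =o[atTop] (fun N : ℕ => Real.log N ^ 2) →
      ∀ (Ω : ℕ → Type*) [∀ N, MeasurableSpace (Ω N)]
        (P : ∀ N, Measure (Ω N)) [∀ N, IsProbabilityMeasure (P N)]
        (A : ∀ N, DenseIndSet.Input N → Ω N → EuclideanSpace ℝ (Fin N)),
        (∀ N, Measurable fun p : DenseIndSet.Input N × Ω N => A N p.1 p.2) →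
        (∀ N, DenseIndSet.IsDegree (A N) (D N)) →
        (∀ᶠ N : ℕ in atTop,
          Integrable (fun p : DenseIndSet.Input N × Ω N => ‖A N p.1 p.2‖ ^ 2)
            ((DenseIndSet.gnpHalf N).prod (P N)) ∧
          ∫ p, ‖A N p.1 p.2‖ ^ 2 ∂((DenseIndSet.gnpHalf N).prod (P N)) ≤ C * Real.log N) →
      ∀ F : ∀ N, (Fin N → Option Bool) → DenseIndSet.Input N → Option (Finset (Fin N)),
        (∀ N, DenseIndSet.IsRepairing b (F N)) →
        Tendsto
          (fun N : ℕ => ((DenseIndSet.gnpHalf N).prod (P N)).real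
            {p | DenseIndSet.IsLargeIndepSet ι p.1
              (DenseIndSet.output (A N) (F N) p.1 p.2)})
          atTop (𝓝 0) := by
  classical
  refine ⟨ι / 12, by positivity, fun C D hD Ω _ P _ A hmeas hdeg hnorm F hF => ?_⟩
  refine tendsto_order.2 ⟨fun a ha => .of_forall fun N => ha.trans_le measureReal_nonneg,
    fun δ hδ => ?_⟩
  have hC : 0 < 4 * (|C| + 1) / δ := by positivity
  filter_upwards [DenseIndSet.eventually_success_lt hι hD (p := min (δ / 2) 1)
    (C := 4 * (|C| + 1) / δ) (by positivity) (min_le_right _ _) hC, hnorm,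
    eventually_ge_atTop 2] with N hN hnormN hN2
  by_contra! hlt
  have hlog : 0 < Real.log N := Real.log_pos (by exact_mod_cast hN2)
  obtain ⟨ω, hω1, hω2⟩ := DenseIndSet.exists_good_realization
    (DenseIndSet.measurableSet_isLargeIndepSet ι (hmeas N) (F N)) (fun p => sq_nonneg _)
    hnormN.1 hδ (c := 4 * (|C| + 1) / δ * Real.log N) (by positivity) (by
      refine hnormN.2.trans ?_
      have : δ / 4 * (4 * (|C| + 1) / δ * Real.log N) = (|C| + 1) * Real.log N := by
        field_simp
      rw [this]
      exact mul_le_mul_of_nonneg_right (by linarith [le_abs_self C]) hlog.le) hlt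
  set G : Finset (DenseIndSet.Input N) := Finset.univ.filter fun y =>
    DenseIndSet.IsLargeIndepSet ι y (DenseIndSet.output (A N) (F N) y ω) with hG
  refine absurd (hN (fun y => A N y ω) (F N) G (hdeg N ω) (hF N)
    (fun y hy => (Finset.mem_filter.1 hy).2) hω1) (not_lt.2 ?_)
  exact (min_le_left _ _).trans (hω2 G fun y => by simp [hG])
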